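/- Consider the $2\times 2$ MIMO X channel with $M_t$ antennas at transmitter $t$ and $N_r$ antennas at receiver $r$ ($t,r\in\{1,2\}$): in every channel use receiver $r$ observes $\mathbf H_{r1}\mathbf x_1+\mathbf H_{r2}\mathbf x_2+\mathbf z_r$, where $\mathbf z_r$ has i.i.d. $\mathcal{CN}(0,1)$ entries (independent over receivers and time), the complex channel matrices $\mathbf H_{rt}$ are constant in time, known everywhere, and drawn with i.i.d. $\mathcal{CN}(0,v)$ entries, $v>0$. Each transmitter has average power at most $P$ and each of the four pairs $(r,t)$ has its own message. A tuple $(d_{rt})$ of degrees of freedom (DoF) is achievable if, for all large $P$, there are rates $R_{rt}(P)$ achievable with vanishing error probability (as the block length tends to infinity) such that $R_{rt}(P)/\log_2P\to d_{rt}$ as $P\to\infty$; its total DoF is $\sum_{r,t} d_{rt}$. **Theorem.** Suppose $M_1\ge M_2\ge N_1\ge N_2$ and $3N_2<M_1+M_2<2N_1+N_2$. Put $$Q_{11}=Q_{21}=M_1-M_2+N_2,\qquad Q_{12}=2(M_2-N_2),\qquad Q_{22}=M_2-M_1+N_2 .$$ (a) There are block lengths $(a_{rt},b_{rt},c_{rt})$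 with $a_{rt}+b_{rt}+c_{rt}=Q_{rt}$, depending only on the antenna numbers, such that for almost every channel realization there are precoding vectors $\mathbf v_{rt}^1,\dots,\mathbf v_{rt}^{a_{rt}}$, $\mathbf w_{rt}^1,\dots,\mathbf w_{rt}^{b_{rt}}$, $\mathbf u_{rt}^1,\dots,\mathbf u_{rt}^{c_{rt}}\in\mathbb C^{M_t}$ with the following properties, where $\bar r$ denotes the receiver other than $r$: - $\mathbf v_{rt}^1,\dots,\mathbf v_{rt}^{a_{rt}}$ are linearly independent over $\mathbb C$ and $\mathbf H_{\bar r t}\mathbf v_{rt}^k=0$; - $b_{rt}\le a_{rt}$ and $\mathbf w_{rt}^k=\mathrm i\,\mathbf v_{rt}^k$; - $c_{r1}=c_{r2}$, the vectors $\mathbf H_{\bar r1}\mathbf u_{r1}^k$ are linearly independent over $\mathbb C$, and $\mathbf H_{\bar r2}\mathbf u_{r2}^k$ and $\mathbf H_{\bar r1}\mathbf u_{r1}^k$ span the same real line for each $k$; - at each receiver $r$, the images under $\mathbf H_{r1},\mathbf H_{r2}$ of all precoding vectors of the streams intended for $r$, together with the aligned interference directions $\mathbf H_{r1}\mathbf u_{\bar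 r1}^k$, are linearly independent over $\mathbb R$; - if each of the $Q_{11}+Q_{21}+Q_{12}+Q_{22}$ streams is encoded separately by a real codebook and its symbols multiply its precoding vector, then all streams simultaneously carry $\tfrac12$ DoF each. (b) For almost every channel realization the DoF tuple $(Q_{rt}/2)$ is therefore achievable, with total $$\frac{Q_{11}+Q_{21}+Q_{12}+Q_{22}}2=\frac{M_1+M_2+N_2}{2},$$ and this meets the outer bound: no achievable DoF tuple has a larger total, so $\frac{M_1+M_2+N_2}{2}$ is the maximal total DoF. -/

import Mathlib

open MeasureTheory ProbabilityTheory Filter Topology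
open scoped BigOperators NNReal Matrix

namespace MIMOX

noncomputable section

/-- Indices of transmitters and receivers are `0, 1 : Fin 2`.  `M t` is the number of antennas of
transmitter `t` and `N r` that of receiver `r`; `H r t` is the matrix (constant in time) from
transmitter `t` to receiver `r`. -/
abbrev Channel (M N : Fin 2 → ℕ) : Type :=
  (r t : Fin 2) → Fin (N r) → Fin (M t) → ℂ

/-- The circularly symmetric complex Gaussian law `CN(0, v)`. -/
def complexGaussian (v : ℝ≥0) : Measure ℂ :=
  ((gaussianReal 0 (v / 2)).prod (gaussianReal 0 (v / 2))).map
    Complex.measurableEquivRealProd.symm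

instance (v : ℝ≥0) : IsProbabilityMeasure (complexGaussian v) :=
  Measure.isProbabilityMeasure_map Complex.measurableEquivRealProd.symm.measurable.aemeasurable

/-- The law of the channel: all entries of all four matrices are i.i.d. `CN(0, v)`. -/
def channelLaw (M N : Fin 2 → ℕ) (v : ℝ≥0) : Measure (Channel M N) :=
  Measure.pi fun r => Measure.pi fun t => Measure.pi fun _ : Fin (N r) =>
    Measure.pi fun _ : Fin (M t) => complexGaussian v

/-- The law of the noise during `n` channel uses: i.i.d. `CN(0, 1)` over receivers, channel uses
and antennas. -/
def noiseLaw (N : Fin 2 → ℕ) (n : ℕ) : Measure ((r : Fin 2) → Fin n → Fin (N r) → ℂ) :=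
  Measure.pi fun r => Measure.pi fun _ : Fin n => Measure.pi fun _ : Fin (N r) =>
    complexGaussian 1

/-- A block code of length `n` for the X channel; `W r t` is the set of messages from
transmitter `t` intended for receiver `r`. -/
structure XCode (M N : Fin 2 → ℕ) (W : Fin 2 → Fin 2 → Type) (n : ℕ) where
  /-- transmitter `t` sends a block depending on its own two messages -/
  enc : (t : Fin 2) → ((r : Fin 2) → W r t) → Fin n → Fin (M t) → ℂ
  /-- receiver `r` estimates the two messages intended for it -/
  dec : (r : Fin 2) → (Fin n → Fin (N r) → ℂ) → (t : Fin 2) → W r t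
  measurable_dec : ∀ r w, MeasurableSet (dec r ⁻¹' {w})

namespace XCode

variable {M N : Fin 2 → ℕ} {W : Fin 2 → Fin 2 → Type} {n : ℕ}

/-- Every transmitted block has average power at most `P`. -/
def PowerLE (c : XCode M N W n) (P : ℝ) : Prop :=
  ∀ t w, ∑ τ, ∑ i, ‖c.enc t w τ i‖ ^ 2 ≤ n * P

/-- The block received by receiver `r` for messages `w` and noise `z`. -/
def output (c : XCode M N W n) (H : Channel M N) (w : (r t : Fin 2) → W r t)
    (z : (r : Fin 2) → Fin n → Fin (N r) → ℂ) (r : Fin 2) : Fin n → Fin (N r) → ℂ :=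
  fun τ => ∑ t, Matrix.of (H r t) *ᵥ c.enc t (fun r' => w r' t) τ + z r τ

/-- The probability that some receiver errs, the messages being uniform and independent. -/
def errorProb [∀ r t, Fintype (W r t)] (c : XCode M N W n) (H : Channel M N) : ℝ :=
  (∑ w : (r t : Fin 2) → W r t,
      (noiseLaw N n).real {z | ∃ r, c.dec r (c.output H w z r) ≠ w r}) /
    Fintype.card ((r t : Fin 2) → W r t)

end XCode

/-- The rates `R r t` (bits per channel use) are achievable at power `P`. -/
def RateAchievable {M N : Fin 2 → ℕ} (H : Channel M N) (P : ℝ) (R : Fin 2 → Fin 2 → ℝ) : Prop :=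
  (∀ r t, 0 ≤ R r t) ∧
  ∀ ε > 0, ∀ᶠ n : ℕ in atTop, ∃ K : Fin 2 → Fin 2 → ℕ,
    (∀ r t, (2 : ℝ) ^ (n * R r t) ≤ K r t) ∧
    ∃ c : XCode M N (fun r t => Fin (K r t)) n, c.PowerLE P ∧ c.errorProb H ≤ ε

/-- The message from `t` to `r` can have `d r t` degrees of freedom, for all four pairs
simultaneously: rates `R r t` with `R r t / log₂ P → d r t` are achievable as `P → ∞`. -/
def DoFAchievable {M N : Fin 2 → ℕ} (H : Channel M N) (d : Fin 2 → Fin 2 → ℝ) : Prop :=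
  ∃ R : ℝ → Fin 2 → Fin 2 → ℝ, (∀ᶠ P in atTop, RateAchievable H P (R P)) ∧
    ∀ r t, Tendsto (fun P => R P r t / Real.logb 2 P) atTop (𝓝 (d r t))

/-- The lengths of the three blocks of each real message vector `m r t`. -/
structure BlockLengths where
  len₁ : Fin 2 → Fin 2 → ℕ
  len₂ : Fin 2 → Fin 2 → ℕ
  len₃ : Fin 2 → Fin 2 → ℕ

/-- The length of the message vector `m r t`. -/
def BlockLengths.total (L : BlockLengths) (r t : Fin 2) : ℕ :=
  L.len₁ r t + L.len₂ r t + L.len₃ r t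

/-- The entries (streams) of the message vector `m r t`, block by block. -/
abbrev BlockLengths.Stream (L : BlockLengths) (r t : Fin 2) : Type :=
  Fin (L.len₁ r t) ⊕ Fin (L.len₂ r t) ⊕ Fin (L.len₃ r t)

/-- Precoding vectors of the three blocks of each message vector. -/
structure Precoders (M : Fin 2 → ℕ) (L : BlockLengths) where
  v : (r t : Fin 2) → Fin (L.len₁ r t) → Fin (M t) → ℂ
  w : (r t : Fin 2) → Fin (L.len₂ r t) → Fin (M t) → ℂ
  u : (r t : Fin 2) → Fin (L.len₃ r t) → Fin (M t) → ℂ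

namespace Precoders

variable {M N : Fin 2 → ℕ} {L : BlockLengths}

/-- The precoding vector of a stream. -/
def vec (p : Precoders M L) (r t : Fin 2) : L.Stream r t → Fin (M t) → ℂ :=
  Sum.elim (p.v r t) (Sum.elim (p.w r t) (p.u r t))

/-- The directions occupied at receiver `r`: those of the streams it desires, then those of the
aligned interference (represented by the third block from transmitter `0` meant for the other
receiver `r.rev`). -/
def received (p : Precoders M L) (H : Channel M N) (r : Fin 2) :
    ((Σ t, L.Stream r t) ⊕ Fin (L.len₃ r.rev 0)) → Fin (N r) → ℂ :=
  Sum.elim (fun s => Matrix.of (H r s.1) *ᵥ p.vec r s.1 s.2)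
    (fun k => Matrix.of (H r 0) *ᵥ p.u r.rev 0 k)

/-- The requirements of the asymmetric interference alignment and cancelation scheme.
`r.rev` is the receiver other than `r`. -/
structure IsAlignmentCancelation (p : Precoders M L) (H : Channel M N) : Prop where
  /-- first blocks: independent vectors, nulled at the unintended receiver -/
  indep_v : ∀ r t, LinearIndependent ℂ (p.v r t)
  null_v : ∀ r t k, Matrix.of (H r.rev t) *ᵥ p.v r t k = 0
  /-- second blocks: the first vectors of the first block multiplied by the imaginary unit -/
  len_le : ∀ r t, L.len₂ r t ≤ L.len₁ r t
  w_eq : ∀ r t k, p.w r t k = Complex.I • p.v r t (Fin.castLE (len_le r t) k)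
  /-- third blocks: not nulled, and aligned one by one in real space at the unintended receiver -/
  len_eq : ∀ r, L.len₃ r 1 = L.len₃ r 0
  indep_u : ∀ r, LinearIndependent ℂ fun k => Matrix.of (H r.rev 0) *ᵥ p.u r 0 k
  align : ∀ r k, Submodule.span ℝ {Matrix.of (H r.rev 1) *ᵥ p.u r 1 k} =
    Submodule.span ℝ {Matrix.of (H r.rev 0) *ᵥ p.u r 0 (Fin.cast (len_eq r) k)}
  /-- at each receiver, desired streams and aligned interference are independent in real space -/
  indep_received : ∀ r, LinearIndependent ℝ (p.received H r)

/-- The code `c` uses the precoders `p`: every stream is encoded on its own by a real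
codebook, and the resulting real symbols are multiplied by the precoding vectors and added. -/
def UsedBy (p : Precoders M L) {K : (r t : Fin 2) → L.Stream r t → ℕ} {n : ℕ}
    (c : XCode M N (fun r t => (s : L.Stream r t) → Fin (K r t s)) n) : Prop :=
  ∃ book : (r t : Fin 2) → (s : L.Stream r t) → Fin (K r t s) → Fin n → ℝ,
    ∀ t w τ, c.enc t w τ = ∑ r, ∑ s, book r t s (w r s) τ • p.vec r t s

/-- With the precoders `p`, the rates `R r t s` of the streams are achievable at power `P`. -/
def RateAchievable (p : Precoders M L) (H : Channel M N) (P : ℝ)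
    (R : (r t : Fin 2) → L.Stream r t → ℝ) : Prop :=
  (∀ r t s, 0 ≤ R r t s) ∧
  ∀ ε > 0, ∀ᶠ n : ℕ in atTop, ∃ K : (r t : Fin 2) → L.Stream r t → ℕ,
    (∀ r t s, (2 : ℝ) ^ (n * R r t s) ≤ K r t s) ∧
    ∃ c : XCode M N (fun r t => (s : L.Stream r t) → Fin (K r t s)) n,
      p.UsedBy c ∧ c.PowerLE P ∧ c.errorProb H ≤ ε

/-- With the precoders `p`, the streams carry `d r t s` degrees of freedom simultaneously. -/
def DoFAchievable (p : Precoders M L) (H : Channel M N)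
    (d : (r t : Fin 2) → L.Stream r t → ℝ) : Prop :=
  ∃ R : ℝ → (r t : Fin 2) → L.Stream r t → ℝ,
    (∀ᶠ P in atTop, p.RateAchievable H P (R P)) ∧
    ∀ r t s, Tendsto (fun P => R P r t s / Real.logb 2 P) atTop (𝓝 (d r t s))

end Precoders

/-- The lengths of the message vectors: row `r`, column `t` is the length of `m r t`. -/
def messageLength (M N : Fin 2 → ℕ) : Matrix (Fin 2) (Fin 2) ℤ :=
  !![M 0 - M 1 + N 1, 2 * (M 1 - N 1);
     M 0 - M 1 + N 1, M 1 - M 0 + N 1]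

end

end MIMOX

/-!
# Degrees of freedom of the 2 × 2 MIMO X channel

**The precoders.**  The vectors of first and second blocks lie in the kernels of the channels to the
unintended receivers, and only messages for receiver `1` use a third block.
Whatever directions `f` are chosen at receiver `0`, both transmitters can hit them because `H 0 t`
is onto, so alignment itself is free; what has to be shown is that all desired streams and the
aligned interference are independent over `ℝ` at each receiver.  At each of the
two receivers this is the injectivity of a real linear map (`recvZeroMap`, `recvOneMap`) that depends
linearly on the channel, on `f`, and on further auxiliary parameters.  The dimensions of source and
target agree exactly under the formulas for the block lengths.  A linear family of linear maps that
has one injective member is injective almost everywhere (`ae_injective_of_linear_family`), and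
explicit members are given in `exists_recvZeroMap_injective` and `exists_recvOneMap_injective`.
Since Gaussian channels are absolutely continuous (`channelLaw_absolutelyContinuous`), Fubini's
theorem makes almost every channel admit suitable auxiliary parameters.

**Half a degree of freedom per stream.**  Independence over `ℝ` gives, for each stream, a real
functional of the received vector that sees only this stream and noise (`exists_zeroForcing`).  Each
stream uses equally spaced amplitudes whose spacing is fixed while their number grows like `√P`,
restricted to a Gilbert–Varshamov code correcting a small fraction of wrong hard decisions.  The
spacing makes such decisions so rare that a crude union bound suffices (`noiseLaw_lt_card_le`), and
the rate loss is an arbitrarily small fraction of `½ log₂ P`.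

**The outer bound.**  Three inequalities `d₀₀ + d₀₁ + d₁ₜ ≤ M t` (`t = 0, 1`) and `d₁₀ + d₁₁ ≤ N 1`
add up to twice the claim.  For the first two, receiver `0`, given the message from the other
transmitter to receiver `1` and `M t - N 0` more noisy linear measurements of the signal of
transmitter `t`, decodes its own messages, cancels the other transmitter, recovers the signal of
transmitter `t` up to bounded noise enhancement, and decodes as receiver `1` would.  Instead of
comparing entropies, the proof counts messages.  Shifted noise is dominated by centred Gaussian noise
of variance `P`, at the price of a factor `P` per complex dimension and of a constant per channel use
(`lintegral_tilt_le`).  Under this common law the decoding regions of distinct messages, being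
disjoint, have total probability at most one (`sum_mul_le_of_successive_decoding`), so that the
number of messages is at most `2 (B P ^ M t) ^ n`.
-/

namespace MIMOX

/-! ### Domination of product measures -/

section Domination

open scoped ENNReal

theorem lintegral_pi_prod {ι : Type*} [Fintype ι] {α : ι → Type*} [∀ i, MeasurableSpace (α i)]
    (μ : ∀ i, Measure (α i)) [∀ i, IsProbabilityMeasure (μ i)] (h : ∀ i, α i → ℝ≥0∞)
    (hh : ∀ i, Measurable (h i)) :
    ∫⁻ x, ∏ i, h i (x i) ∂Measure.pi μ = ∏ i, ∫⁻ y, h i y ∂μ i := by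
  have hind : iIndepFun (fun i (x : ∀ i, α i) => h i (x i)) (Measure.pi μ) :=
    iIndepFun_pi fun i => (hh i).aemeasurable
  have h1 := lintegral_prod_eq_prod_lintegral_of_indepFun Finset.univ _ hind
    (fun i => (hh i).comp (measurable_pi_apply i))
  rw [h1]
  refine Finset.prod_congr rfl fun i _ => ?_
  exact (measurePreserving_eval μ i).lintegral_comp (hh i)

/-- If each factor, reweighted by `h i`, is at most `c i` times another measure, then the product,
reweighted by the product of the weights, is at most `∏ i, c i` times the product. -/
theorem withDensity_pi_le {ι : Type*} [Fintype ι] {α : ι → Type*} [∀ i, MeasurableSpace (α i)]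
    (μ ν : ∀ i, Measure (α i)) [∀ i, IsProbabilityMeasure (μ i)] [∀ i, SigmaFinite (ν i)]
    (h : ∀ i, α i → ℝ≥0∞) (hh : ∀ i, Measurable (h i)) (c : ι → ℝ≥0)
    (hc : ∀ i, (μ i).withDensity (h i) ≤ c i • ν i) :
    (Measure.pi μ).withDensity (fun x => ∏ i, h i (x i)) ≤ (∏ i, c i) • Measure.pi ν := by
  have hsmul : Measure.pi (fun i => c i • ν i) = (∏ i, c i) • Measure.pi ν := by
    refine Measure.pi_eq fun s _ => ?_
    simp only [Measure.smul_apply, ENNReal.smul_def, smul_eq_mul, Finset.prod_mul_distrib,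
      Measure.pi_pi, ENNReal.ofNNReal_finsetProd]
  rw [← hsmul]
  refine Measure.le_iff.2 fun S hS => ?_
  have key : ((Measure.pi μ).withDensity (fun x => ∏ i, h i (x i))).toOuterMeasure ≤
      OuterMeasure.pi fun i => (c i • ν i).toOuterMeasure := by
    refine OuterMeasure.le_pi.2 fun s _ => ?_
    set t : ∀ i, Set (α i) := fun i => toMeasurable (c i • ν i) (s i) with ht
    have htm : ∀ i, MeasurableSet (t i) := fun i => measurableSet_toMeasurable _ _
    have hst : Set.pi Set.univ s ⊆ Set.pi Set.univ t :=
      Set.pi_mono fun i _ => subset_toMeasurable _ _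
    refine (measure_mono hst).trans ?_
    change ((Measure.pi μ).withDensity (fun x => ∏ i, h i (x i))) (Set.pi Set.univ t) ≤ _
    rw [withDensity_apply _ (MeasurableSet.univ_pi htm), ← lintegral_indicator
      (MeasurableSet.univ_pi htm)]
    have h2 : (Set.pi Set.univ t).indicator (fun x : ∀ i, α i => ∏ i, h i (x i)) =
        fun x => ∏ i, (t i).indicator (h i) (x i) := by
      ext x
      by_cases hx : x ∈ Set.pi Set.univ t
      · rw [Set.indicator_of_mem hx]
        exact Finset.prod_congr rfl fun i _ => (Set.indicator_of_mem (hx i trivial) _).symm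
      · rw [Set.indicator_of_notMem hx]
        simp only [Set.mem_pi, Set.mem_univ, true_imp_iff, not_forall] at hx
        obtain ⟨i, hi⟩ := hx
        exact (Finset.prod_eq_zero (Finset.mem_univ i) (Set.indicator_of_notMem hi _)).symm
    rw [h2, lintegral_pi_prod μ _ fun i => (hh i).indicator (htm i)]
    refine Finset.prod_le_prod' fun i _ => ?_
    rw [lintegral_indicator (htm i), ← withDensity_apply _ (htm i)]
    refine (hc i (t i)).trans ?_
    exact (measure_toMeasurable (μ := c i • ν i) (s i)).le
  have h3 : Measure.pi (fun i => c i • ν i) S =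
      OuterMeasure.pi (fun i => (c i • ν i).toOuterMeasure) S := by
    rw [Measure.pi, toMeasure_apply _ _ hS]
  rw [h3]
  exact key S

theorem pi_le_smul_pi {ι : Type*} [Fintype ι] {α : ι → Type*} [∀ i, MeasurableSpace (α i)]
    (μ ν : ∀ i, Measure (α i)) [∀ i, IsProbabilityMeasure (μ i)] [∀ i, SigmaFinite (ν i)]
    (c : ι → ℝ≥0) (hc : ∀ i, μ i ≤ c i • ν i) :
    Measure.pi μ ≤ (∏ i, c i) • Measure.pi ν := by
  have := withDensity_pi_le μ ν (fun _ _ => 1) (fun _ => measurable_const) c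
    (fun i => by simpa [← Pi.one_def] using hc i)
  simpa [← Pi.one_def] using this

end Domination

/-! ### Complex Gaussian laws -/

section Gaussian

/-- The density of `CN(0, v)` with respect to Lebesgue measure. -/
theorem complexGaussian_eq_withDensity {v : ℝ≥0} (hv : v ≠ 0) :
    complexGaussian v = (volume : Measure ℂ).withDensity
      (fun z => ENNReal.ofReal ((Real.pi * v)⁻¹ * Real.exp (-‖z‖ ^ 2 / v))) := by
  have hv2 : v / 2 ≠ 0 := div_ne_zero hv two_ne_zero
  have hmp := Complex.volume_preserving_equiv_real_prod
  rw [complexGaussian, gaussianReal_of_var_ne_zero _ hv2,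
    prod_withDensity (measurable_gaussianPDF _ _) (measurable_gaussianPDF _ _)]
  ext s hs
  rw [Measure.map_apply Complex.measurableEquivRealProd.symm.measurable hs,
    withDensity_apply _ (Complex.measurableEquivRealProd.symm.measurable hs),
    withDensity_apply _ hs]
  rw [← hmp.symm.setLIntegral_comp_preimage_emb
    Complex.measurableEquivRealProd.symm.measurableEmbedding]
  refine setLIntegral_congr_fun (Complex.measurableEquivRealProd.symm.measurable hs) ?_
  rintro ⟨x, y⟩ -
  have hv0 : (0 : ℝ) < v := by positivity
  have e1 : √(2 * Real.pi * (v / 2 : ℝ≥0)) = √(Real.pi * v) := by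
    congr 1; push_cast; ring
  simp only [gaussianPDF, gaussianPDFReal]
  rw [← ENNReal.ofReal_mul (by positivity), e1]
  congr 1
  have e2 : ‖(Complex.measurableEquivRealProd.symm (x, y) : ℂ)‖ ^ 2 = x ^ 2 + y ^ 2 := by
    rw [← Complex.normSq_eq_norm_sq, Complex.normSq_apply]
    simp [Complex.measurableEquivRealProd]
    ring
  rw [e2]
  have e3 : (√(Real.pi * v))⁻¹ * (√(Real.pi * v))⁻¹ = (Real.pi * (v : ℝ))⁻¹ := by
    rw [← mul_inv, Real.mul_self_sqrt (by positivity)]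
  rw [mul_mul_mul_comm, e3, ← Real.exp_add]
  congr 2
  push_cast
  field_simp
  ring

theorem complexGaussian_le_volume {v : ℝ≥0} (hv : v ≠ 0) :
    complexGaussian v ≤ (Real.toNNReal (Real.pi * v)⁻¹) • (volume : Measure ℂ) := by
  rw [complexGaussian_eq_withDensity hv]
  have : ((Real.toNNReal (Real.pi * v)⁻¹) • (volume : Measure ℂ)) =
    (volume : Measure ℂ).withDensity (fun _ => ENNReal.ofReal (Real.pi * v)⁻¹) := by
    rw [withDensity_const]; rfl
  rw [this]
  refine withDensity_mono (ae_of_all _ fun z => ENNReal.ofReal_le_ofReal ?_)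
  have hv0 : (0 : ℝ) < v := by positivity
  refine mul_le_of_le_one_right (by positivity) (Real.exp_le_one_iff.2 ?_)
  rw [neg_div]
  exact neg_nonpos.2 (by positivity)

theorem channelLaw_absolutelyContinuous (M N : Fin 2 → ℕ) {v : ℝ≥0} (hv : v ≠ 0) :
    channelLaw M N v ≪ (volume : Measure (Channel M N)) := by
  set c : ℝ≥0 := Real.toNNReal (Real.pi * v)⁻¹
  have h : channelLaw M N v ≤ (∏ r : Fin 2, ∏ t : Fin 2, ∏ _ : Fin (N r), ∏ _ : Fin (M t), c) •
      (volume : Measure (Channel M N)) :=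
    pi_le_smul_pi _ (fun _ => volume) _ fun r => pi_le_smul_pi _ (fun _ => volume) _ fun t =>
      pi_le_smul_pi _ (fun _ => volume) _ fun _ => pi_le_smul_pi _ (fun _ => volume) _ fun _ =>
        complexGaussian_le_volume hv
  exact Measure.absolutelyContinuous_of_le_smul (c := ((∏ r : Fin 2, ∏ t : Fin 2, ∏ _ : Fin (N r),
    ∏ _ : Fin (M t), c : ℝ≥0) : ENNReal)) h

end Gaussian

/-! ### Generic injectivity in linear families -/

section Generic

/-- In a family of linear maps depending linearly on a parameter, almost every member is injective
as soon as one is. Along each line in the direction `θ₀` of an injective member, composition with a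
left inverse of that member gives `A + t • id`, which is singular for finitely many `t` only. -/
theorem ae_injective_of_linear_family {Θ E F : Type*} [NormedAddCommGroup Θ] [NormedSpace ℝ Θ]
    [FiniteDimensional ℝ Θ] [MeasurableSpace Θ] [BorelSpace Θ] (μ : Measure Θ)
    [μ.IsAddHaarMeasure] [AddCommGroup E] [Module ℝ E] [FiniteDimensional ℝ E]
    [AddCommGroup F] [Module ℝ F] (f : Θ → E → F) (hf : ∀ θ, IsLinearMap ℝ (f θ))
    (hf' : ∀ x, IsLinearMap ℝ fun θ => f θ x) (θ₀ : Θ) (h₀ : ∀ x, f θ₀ x = 0 → x = 0) :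
    ∀ᵐ θ ∂μ, ∀ x, f θ x = 0 → x = 0 := by
  let T : Θ →ₗ[ℝ] E →ₗ[ℝ] F := LinearMap.mk₂ ℝ f (fun θ θ' x => (hf' x).map_add θ θ')
    (fun c θ x => (hf' x).map_smul c θ) (fun θ x y => (hf θ).map_add x y)
    (fun c θ x => (hf θ).map_smul c x)
  have hT : ∀ θ x, T θ x = f θ x := fun θ x => rfl
  obtain ⟨S, hS⟩ := (T θ₀).exists_leftInverse_of_injective
    (LinearMap.ker_eq_bot'.2 fun x hx => h₀ x hx)
  let A : Θ →ₗ[ℝ] E →ₗ[ℝ] E := (LinearMap.llcomp ℝ E F E S).comp T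
  have hA : ∀ θ, A θ = S ∘ₗ T θ := fun θ => rfl
  let b := Module.finBasis ℝ E
  have hcont : Continuous fun θ => LinearMap.det (A θ) := by
    have h1 : Continuous fun θ => LinearMap.toMatrix b b (A θ) :=
      ((LinearMap.toMatrix b b).toLinearMap.comp A).continuous_of_finiteDimensional
    simpa [LinearMap.det_toMatrix] using h1.matrix_det
  have hs : MeasurableSet {θ | LinearMap.det (A θ) ≠ 0} :=
    (isOpen_ne_fun hcont continuous_const).measurableSet
  have key : ∀ᵐ θ ∂μ, θ ∈ {θ | LinearMap.det (A θ) ≠ 0} := by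
    refine ae_mem_of_ae_add_linearMap_mem (LinearMap.toSpanSingleton ℝ Θ θ₀) volume μ hs ?_
    intro y
    have hfin : {t : ℝ | (LinearMap.charpoly (-(A y))).IsRoot t}.Finite :=
      Polynomial.finite_setOfPred_isRoot (LinearMap.charpoly_monic _).ne_zero
    refine (measure_mono_null ?_ (hfin.measure_zero volume))
    intro t ht
    have ht' : LinearMap.det (A (y + t • θ₀)) = 0 := by
      by_contra h
      exact ht h
    simp only [Set.mem_ofPred_eq, Polynomial.IsRoot, LinearMap.eval_charpoly]
    rw [← ht']
    congr 1
    rw [map_add, map_smul, hA θ₀, hS]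
    ext x
    simp [add_comm]
  filter_upwards [key] with θ hθ x hx
  have h1 : A θ x = 0 := by rw [hA, LinearMap.comp_apply, hT, hx, map_zero]
  by_contra hne
  exact hθ (LinearMap.det_eq_zero_iff_ker_ne_bot.2 fun hbot => hne
    (LinearMap.ker_eq_bot'.1 hbot x h1))

theorem isAddHaarMeasure_volume_pi {ι : Type*} [Fintype ι] {G : ι → Type*}
    [∀ i, NormedAddCommGroup (G i)] [∀ i, MeasureSpace (G i)] [∀ i, BorelSpace (G i)]
    [∀ i, SecondCountableTopology (G i)] [∀ i, SigmaFinite (volume : Measure (G i))]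
    [∀ i, (volume : Measure (G i)).IsAddHaarMeasure] :
    (volume : Measure (∀ i, G i)).IsAddHaarMeasure :=
  inferInstance

instance isAddHaarMeasure_volume_matrix (m n : ℕ) :
    (volume : Measure (Fin n → Fin m → ℂ)).IsAddHaarMeasure :=
  isAddHaarMeasure_volume_pi

instance isAddHaarMeasure_volume_channel (M N : Fin 2 → ℕ) :
    (volume : Measure (Channel M N)).IsAddHaarMeasure := by
  have (r : Fin 2) : (volume : Measure ((t : Fin 2) → Fin (N r) → Fin (M t) → ℂ)).IsAddHaarMeasure :=
    isAddHaarMeasure_volume_pi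
  exact isAddHaarMeasure_volume_pi

theorem exists_pi_fin_two_two {α : Fin 2 → Fin 2 → Sort*} (a : α 0 0) (b : α 0 1) (c : α 1 0)
    (d : α 1 1) : ∃ f : ∀ r t, α r t, f 0 0 = a ∧ f 0 1 = b ∧ f 1 0 = c ∧ f 1 1 = d :=
  ⟨fun r t => match r, t with
    | 0, 0 => a
    | 0, 1 => b
    | 1, 0 => c
    | 1, 1 => d, rfl, rfl, rfl, rfl⟩

/-- The channel whose matrices represent the given linear maps. -/
noncomputable def channelOfLinear {M N : Fin 2 → ℕ}
    (L : ∀ r t : Fin 2, (Fin (M t) → ℂ) →ₗ[ℂ] (Fin (N r) → ℂ)) : Channel M N :=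
  fun r t => LinearMap.toMatrix' (L r t)

theorem channelOfLinear_mulVec {M N : Fin 2 → ℕ}
    (L : ∀ r t : Fin 2, (Fin (M t) → ℂ) →ₗ[ℂ] (Fin (N r) → ℂ)) (r t : Fin 2) (x : Fin (M t) → ℂ) :
    Matrix.of (channelOfLinear L r t) *ᵥ x = L r t x :=
  LinearMap.toMatrix'_mulVec _ _

theorem ae_mulVec_surjective {M N : Fin 2 → ℕ} (r t : Fin 2) (h : N r ≤ M t) :
    ∀ᵐ H ∂(volume : Measure (Channel M N)),
      Function.Surjective fun x : Fin (M t) → ℂ => Matrix.of (H r t) *ᵥ x := by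
  have h1 := ae_injective_of_linear_family (volume : Measure (Channel M N))
    (fun H (y : Fin (N r) → ℂ) => y ᵥ* Matrix.of (H r t))
    (fun H => ⟨fun x y => Matrix.add_vecMul _ _ _, fun a x => Matrix.smul_vecMul _ _ _⟩)
    (fun y => ⟨fun H H' => Matrix.vecMul_add (Matrix.of (H r t)) (Matrix.of (H' r t)) y,
      fun a H => Matrix.vecMul_smul y a (Matrix.of (H r t))⟩)
    (fun _ _ i j => if j.val = i.val then (1 : ℂ) else 0) (by
      intro y hy
      ext i
      have := congrFun hy (Fin.castLE h i)
      have h2 : ∀ x : Fin (N r), (i.val = x.val) = (i = x) := fun x => by rw [Fin.ext_iff]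
      simpa [Matrix.vecMul, dotProduct, h2] using this)
  filter_upwards [h1] with H hH
  have hinj : Function.Injective (Matrix.of (H r t)).vecMul := by
    intro y y' hyy
    have : y - y' = 0 := hH _ (by rw [Matrix.sub_vecMul]; exact sub_eq_zero.2 hyy)
    exact sub_eq_zero.1 this
  have hli := Matrix.vecMul_injective_iff.1 hinj
  have hrank : (Matrix.of (H r t)).rank = N r := by
    rw [LinearIndependent.rank_matrix hli, Fintype.card_fin]
  have hr : LinearMap.range (Matrix.of (H r t)).mulVecLin = ⊤ := by
    apply Submodule.eq_top_of_finrank_eq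
    rw [← Matrix.rank, hrank]; simp
  intro y
  obtain ⟨x, hx⟩ := LinearMap.range_eq_top.1 hr y
  exact ⟨x, hx⟩

end Generic

/-! ### Generic alignment -/

section Alignment

/-- Real combination of the first-block and second-block vectors built on `g`: the vectors `g k`
and, for `k < b`, also `i • g k`. -/
noncomputable def pairComb {b d : ℕ} {V : Type*} [AddCommGroup V] [Module ℂ V]
    (g : Fin (b + d) → V) (α : Fin (b + d) → ℝ) (β : Fin b → ℝ) : V :=
  ∑ k, (α k : ℂ) • g k + ∑ k, ((β k : ℂ) * Complex.I) • g (Fin.castAdd d k)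

theorem pairComb_add {b d : ℕ} {V : Type*} [AddCommGroup V] [Module ℂ V]
    (g g' : Fin (b + d) → V) (α : Fin (b + d) → ℝ) (β : Fin b → ℝ) :
    pairComb (g + g') α β = pairComb g α β + pairComb g' α β := by
  simp only [pairComb, Pi.add_apply, smul_add, Finset.sum_add_distrib]
  abel

theorem pairComb_smul {b d : ℕ} {V : Type*} [AddCommGroup V] [Module ℂ V]
    (a : ℝ) (g : Fin (b + d) → V) (α : Fin (b + d) → ℝ) (β : Fin b → ℝ) :
    pairComb ((a : ℂ) • g) α β = (a : ℂ) • pairComb g α β := by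
  simp only [pairComb, Pi.smul_apply, smul_add, Finset.smul_sum, smul_comm (a : ℂ)]

theorem pairComb_add_coeff {b d : ℕ} {V : Type*} [AddCommGroup V] [Module ℂ V]
    (g : Fin (b + d) → V) (α α' : Fin (b + d) → ℝ) (β β' : Fin b → ℝ) :
    pairComb g (α + α') (β + β') = pairComb g α β + pairComb g α' β' := by
  simp only [pairComb, Pi.add_apply, Complex.ofReal_add, add_mul, add_smul, Finset.sum_add_distrib]
  abel

theorem pairComb_smul_coeff {b d : ℕ} {V : Type*} [AddCommGroup V] [Module ℂ V]
    (a : ℝ) (g : Fin (b + d) → V) (α : Fin (b + d) → ℝ) (β : Fin b → ℝ) :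
    pairComb g (a • α) (a • β) = (a : ℂ) • pairComb g α β := by
  simp only [pairComb, Pi.smul_apply, smul_eq_mul, Complex.ofReal_mul, smul_add, Finset.smul_sum,
    smul_smul, mul_assoc]

theorem map_pairComb {b d : ℕ} {V W : Type*} [AddCommGroup V] [Module ℂ V] [AddCommGroup W]
    [Module ℂ W] (L : V →ₗ[ℂ] W) (g : Fin (b + d) → V) (α : Fin (b + d) → ℝ) (β : Fin b → ℝ) :
    L (pairComb g α β) = pairComb (fun k => L (g k)) α β := by
  simp [pairComb]

theorem real_smul_eq {V : Type*} [AddCommGroup V] [Module ℂ V] (a : ℝ) (x : V) :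
    a • x = (a : ℂ) • x := rfl

variable {M N : Fin 2 → ℕ} {b d c k : ℕ}

/-- The equations of the streams at receiver `0`: `x.1` is a combination of vectors nulled at
receiver `1` with prescribed second coordinates `g`, `x.2.1` is nulled at receiver `1`, and the two
images at receiver `0` cancel against a real combination of the interference directions `f`. -/
noncomputable def recvZeroMap
    (θ : Channel M N × (Fin c → Fin (N 0) → ℂ) × (Fin (b + d) → Fin k → ℂ) ×
      (Fin k → Fin (M 0) → ℂ))
    (x : (Fin (M 0) → ℂ) × (Fin (M 1) → ℂ) × (Fin (b + d) → ℝ) × (Fin b → ℝ) × (Fin c → ℝ)) :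
    (Fin (N 1) → ℂ) × (Fin k → ℂ) × (Fin (N 1) → ℂ) × (Fin (N 0) → ℂ) :=
  (Matrix.of (θ.1 1 0) *ᵥ x.1,
    Matrix.of θ.2.2.2 *ᵥ x.1 - pairComb θ.2.2.1 x.2.2.1 x.2.2.2.1,
    Matrix.of (θ.1 1 1) *ᵥ x.2.1,
    Matrix.of (θ.1 0 0) *ᵥ x.1 + Matrix.of (θ.1 0 1) *ᵥ x.2.1 +
      ∑ l, (x.2.2.2.2 l : ℂ) • θ.2.1 l)

/-- The equations of the streams at receiver `1`: transmitter `t` sends a vector whose image at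
receiver `0` is a real combination of the aligned directions `f`, and the two images at receiver `1`
cancel. -/
noncomputable def recvOneMap
    (θ : Channel M N × (Fin c → Fin (N 0) → ℂ))
    (x : (Fin (M 0) → ℂ) × (Fin (M 1) → ℂ) × (Fin c → ℝ) × (Fin c → ℝ)) :
    (Fin (N 0) → ℂ) × (Fin (N 0) → ℂ) × (Fin (N 1) → ℂ) :=
  (Matrix.of (θ.1 0 0) *ᵥ x.1 - ∑ l, (x.2.2.1 l : ℂ) • θ.2 l,
    Matrix.of (θ.1 0 1) *ᵥ x.2.1 - ∑ l, (x.2.2.2 l : ℂ) • θ.2 l,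
    Matrix.of (θ.1 1 0) *ᵥ x.1 + Matrix.of (θ.1 1 1) *ᵥ x.2.1)

theorem of_add_mulVec {m n : ℕ} (A B : Fin m → Fin n → ℂ) (x : Fin n → ℂ) :
    Matrix.of (A + B) *ᵥ x = Matrix.of A *ᵥ x + Matrix.of B *ᵥ x :=
  Matrix.add_mulVec (Matrix.of A) (Matrix.of B) x

theorem of_smul_mulVec {m n : ℕ} (a : ℂ) (A : Fin m → Fin n → ℂ) (x : Fin n → ℂ) :
    Matrix.of (a • A) *ᵥ x = a • Matrix.of A *ᵥ x :=
  Matrix.smul_mulVec a (Matrix.of A) x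

theorem isLinearMap_recvZeroMap (θ : Channel M N × (Fin c → Fin (N 0) → ℂ) ×
    (Fin (b + d) → Fin k → ℂ) × (Fin k → Fin (M 0) → ℂ)) : IsLinearMap ℝ (recvZeroMap θ) := by
  constructor
  · intro x y
    simp only [recvZeroMap, Prod.fst_add, Prod.snd_add, Matrix.mulVec_add, pairComb_add_coeff,
      Pi.add_apply, Complex.ofReal_add, add_smul, Finset.sum_add_distrib, Prod.mk_add_mk]
    refine Prod.ext rfl (Prod.ext ?_ (Prod.ext rfl ?_)) <;> dsimp only <;> abel
  · intro a x
    simp only [recvZeroMap, Prod.smul_fst, Prod.smul_snd, real_smul_eq, Matrix.mulVec_smul,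
      Prod.smul_mk, smul_add, smul_sub, Finset.smul_sum]
    have h1 := pairComb_smul_coeff a θ.2.2.1 x.2.2.1 x.2.2.2.1
    refine Prod.ext rfl (Prod.ext ?_ (Prod.ext rfl ?_)) <;> dsimp only
    · rw [← h1]
    · simp only [Pi.smul_apply, smul_eq_mul, Complex.ofReal_mul, mul_smul]

theorem isLinearMap_recvZeroMap_left
    (x : (Fin (M 0) → ℂ) × (Fin (M 1) → ℂ) × (Fin (b + d) → ℝ) × (Fin b → ℝ) × (Fin c → ℝ)) :
    IsLinearMap ℝ fun θ : Channel M N × (Fin c → Fin (N 0) → ℂ) ×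
    (Fin (b + d) → Fin k → ℂ) × (Fin k → Fin (M 0) → ℂ) => recvZeroMap θ x := by
  constructor
  · intro θ θ'
    simp only [recvZeroMap, Prod.fst_add, Prod.snd_add, Pi.add_apply, of_add_mulVec, pairComb_add,
      smul_add, Finset.sum_add_distrib, Prod.mk_add_mk]
    refine Prod.ext rfl (Prod.ext ?_ (Prod.ext rfl ?_)) <;> dsimp only <;> abel
  · intro a θ
    simp only [recvZeroMap, Prod.smul_fst, Prod.smul_snd, Pi.smul_apply, real_smul_eq,
      of_smul_mulVec, Prod.smul_mk, pairComb_smul, smul_add, smul_sub, Finset.smul_sum,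
      smul_comm (a : ℂ)]

theorem isLinearMap_recvOneMap (θ : Channel M N × (Fin c → Fin (N 0) → ℂ)) :
    IsLinearMap ℝ (recvOneMap θ) := by
  constructor
  · intro x y
    simp only [recvOneMap, Prod.fst_add, Prod.snd_add, Matrix.mulVec_add,
      Pi.add_apply, Complex.ofReal_add, add_smul, Finset.sum_add_distrib, Prod.mk_add_mk]
    refine Prod.ext ?_ (Prod.ext ?_ ?_) <;> dsimp only <;> abel
  · intro a x
    simp only [recvOneMap, Prod.smul_fst, Prod.smul_snd, real_smul_eq, Matrix.mulVec_smul,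
      Prod.smul_mk, smul_add, smul_sub, Finset.smul_sum]
    refine Prod.ext ?_ (Prod.ext ?_ rfl) <;>
      simp only [Pi.smul_apply, smul_eq_mul, Complex.ofReal_mul, mul_smul]

theorem isLinearMap_recvOneMap_left
    (x : (Fin (M 0) → ℂ) × (Fin (M 1) → ℂ) × (Fin c → ℝ) × (Fin c → ℝ)) :
    IsLinearMap ℝ fun θ : Channel M N × (Fin c → Fin (N 0) → ℂ) => recvOneMap θ x := by
  constructor
  · intro θ θ'
    simp only [recvOneMap, Prod.fst_add, Prod.snd_add, Pi.add_apply, of_add_mulVec,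
      smul_add, Finset.sum_add_distrib, Prod.mk_add_mk]
    refine Prod.ext ?_ (Prod.ext ?_ ?_) <;> dsimp only <;> abel
  · intro a θ
    simp only [recvOneMap, Prod.smul_fst, Prod.smul_snd, Pi.smul_apply, real_smul_eq,
      of_smul_mulVec, Prod.smul_mk, smul_add, smul_sub, Finset.smul_sum,
      smul_comm (a : ℂ)]

end Alignment

/-! ### Injective members of the two families -/

section Witness

variable {M N : Fin 2 → ℕ} {b d c k : ℕ}

theorem pairComb_single_castAdd (h : b + d ≤ k) (α : Fin (b + d) → ℝ) (β : Fin b → ℝ) (j : Fin b) :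
    pairComb (fun i => (Pi.single (Fin.castLE h i) 1 : Fin k → ℂ)) α β
      (Fin.castLE h (Fin.castAdd d j)) = α (Fin.castAdd d j) + β j * Complex.I := by
  simp [pairComb, Pi.single_apply]

theorem pairComb_single_natAdd (h : b + d ≤ k) (α : Fin (b + d) → ℝ) (β : Fin b → ℝ) (j : Fin d) :
    pairComb (fun i => (Pi.single (Fin.castLE h i) 1 : Fin k → ℂ)) α β
      (Fin.castLE h (Fin.natAdd b j)) = α (Fin.natAdd b j) := by
  have h1 : ∀ i : Fin b, Fin.natAdd b j ≠ Fin.castAdd d i := fun i hi => by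
    have := congrArg Fin.val hi
    simp at this
    omega
  simp [pairComb, Pi.single_apply, h1]

/-- In the witness, receiver `0` sees the coordinates of transmitter `0` that carry a pair of
streams in `b` of its dimensions and those of transmitter `1` in `k₁` others.  The unpaired streams
and the interference directions `f` form together an `ℝ`-basis of the remaining dimensions. -/
theorem exists_recvZeroMap_injective {k₁ : ℕ} (h0 : N 1 + k = M 0) (h1 : N 1 + k₁ = M 1)
    (hbd : b + d ≤ k) (hdim : 2 * b + d + 2 * k₁ + c = 2 * N 0) :
    ∃ θ : Channel M N × (Fin c → Fin (N 0) → ℂ) × (Fin (b + d) → Fin k → ℂ) ×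
      (Fin k → Fin (M 0) → ℂ), ∀ x, recvZeroMap θ x = 0 → x = 0 := by
  obtain ⟨m, hm⟩ : ∃ m, b + k₁ + m = N 0 := ⟨N 0 - (b + k₁), by omega⟩
  obtain ⟨e0⟩ : Nonempty ((Fin (M 0) → ℂ) ≃ₗ[ℂ] (Fin (N 1) → ℂ) × (Fin k → ℂ)) :=
    ⟨LinearEquiv.ofFinrankEq _ _ (by simp [h0])⟩
  obtain ⟨e1⟩ : Nonempty ((Fin (M 1) → ℂ) ≃ₗ[ℂ] (Fin (N 1) → ℂ) × (Fin k₁ → ℂ)) :=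
    ⟨LinearEquiv.ofFinrankEq _ _ (by simp [h1])⟩
  obtain ⟨e⟩ : Nonempty ((Fin (N 0) → ℂ) ≃ₗ[ℂ] (Fin b → ℂ) × (Fin k₁ → ℂ) × (Fin m → ℂ)) :=
    ⟨LinearEquiv.ofFinrankEq _ _ (by simp; omega)⟩
  obtain ⟨Ψ⟩ : Nonempty (((Fin d → ℝ) × (Fin c → ℝ)) ≃ₗ[ℝ] (Fin m → ℂ)) :=
    ⟨LinearEquiv.ofFinrankEq _ _ (by simp [Module.finrank_pi_fintype]; omega)⟩
  -- the `ℝ`-basis `Ψ` of the last `m` dimensions is split into `d` unpaired streams, entering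
  -- through the `ℂ`-linear map `Φ`, and `c` interference directions
  let g : Fin (b + d) → Fin k → ℂ := fun i => Pi.single (Fin.castLE hbd i) 1
  let Φ : (Fin k → ℂ) →ₗ[ℂ] (Fin m → ℂ) := ∑ j : Fin d,
    (LinearMap.proj (Fin.castLE hbd (Fin.natAdd b j)) : (Fin k → ℂ) →ₗ[ℂ] ℂ).smulRight
      (Ψ (Pi.single j 1, 0))
  let pb : (Fin k → ℂ) →ₗ[ℂ] (Fin b → ℂ) :=
    LinearMap.funLeft ℂ ℂ fun j => Fin.castLE hbd (Fin.castAdd d j)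
  let f : Fin c → Fin (N 0) → ℂ := fun l => e.symm (0, 0, Ψ (0, Pi.single l 1))
  obtain ⟨L, hL00, hL01, hL10, hL11⟩ := exists_pi_fin_two_two
    (α := fun r t => (Fin (M t) → ℂ) →ₗ[ℂ] (Fin (N r) → ℂ))
    (e.symm.toLinearMap ∘ₗ (pb.prod ((0 : (Fin k → ℂ) →ₗ[ℂ] (Fin k₁ → ℂ)).prod Φ)) ∘ₗ
      LinearMap.snd ℂ _ _ ∘ₗ e0.toLinearMap)
    (e.symm.toLinearMap ∘ₗ LinearMap.inr ℂ _ _ ∘ₗ LinearMap.inl ℂ _ _ ∘ₗ LinearMap.snd ℂ _ _ ∘ₗ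
      e1.toLinearMap)
    (LinearMap.fst ℂ _ _ ∘ₗ e0.toLinearMap) (LinearMap.fst ℂ _ _ ∘ₗ e1.toLinearMap)
  let T : (Fin (M 0) → ℂ) →ₗ[ℂ] (Fin k → ℂ) := LinearMap.snd ℂ _ _ ∘ₗ e0.toLinearMap
  obtain ⟨Th, hTh⟩ : ∃ Th : Fin k → Fin (M 0) → ℂ, ∀ x, Matrix.of Th *ᵥ x = (e0 x).2 :=
    ⟨LinearMap.toMatrix' T, fun x => LinearMap.toMatrix'_mulVec T x⟩
  refine ⟨(channelOfLinear L, f, g, Th), fun x hx => ?_⟩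
  obtain ⟨x0, x1, α, β, l⟩ := x
  have hx00 : L 0 0 x0 = e.symm (pb (e0 x0).2, 0, Φ (e0 x0).2) := by rw [hL00]; rfl
  have hx01 : L 0 1 x1 = e.symm (0, (e1 x1).2, 0) := by rw [hL01]; rfl
  have hx10 : L 1 0 x0 = (e0 x0).1 := by rw [hL10]; rfl
  have hx11 : L 1 1 x1 = (e1 x1).1 := by rw [hL11]; rfl
  simp only [recvZeroMap, channelOfLinear_mulVec, hx00, hx01, hx10, hx11, hTh, Prod.mk_eq_zero]
    at hx
  obtain ⟨q1, q2, q3, q4⟩ := hx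
  have q2 : (e0 x0).2 = pairComb g α β := sub_eq_zero.1 q2
  have q5 := congrArg e q4
  simp only [f, map_add, map_sum, map_smul, LinearEquiv.apply_symm_apply, map_zero, q2] at q5
  have hsum : ∑ i, (l i : ℂ) • ((0, 0, Ψ (0, Pi.single i 1)) :
      (Fin b → ℂ) × (Fin k₁ → ℂ) × (Fin m → ℂ)) = (0, 0, Ψ (0, l)) := by
    have : (0, l) = ∑ i, l i • ((0, Pi.single i 1) : (Fin d → ℝ) × (Fin c → ℝ)) := by
      refine Prod.ext ?_ ?_
      · simp [Prod.fst_sum]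
      · ext j
        simp [Prod.snd_sum, Pi.single_apply]
    rw [this, map_sum]
    simp only [map_smul]
    refine Prod.ext ?_ (Prod.ext ?_ ?_)
    · simp [Prod.fst_sum]
    · simp [Prod.fst_sum, Prod.snd_sum]
    · simp [Prod.snd_sum]
  rw [hsum] at q5
  simp only [Prod.mk_add_mk, Prod.mk_eq_zero, add_zero, zero_add] at q5
  obtain ⟨q6, q7, q8⟩ := q5
  have hΦ : Φ (pairComb g α β) = Ψ (fun j => α (Fin.natAdd b j), 0) := by
    have : ((fun j => α (Fin.natAdd b j), 0) : (Fin d → ℝ) × (Fin c → ℝ)) =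
        ∑ j, α (Fin.natAdd b j) • ((Pi.single j 1, 0) : (Fin d → ℝ) × (Fin c → ℝ)) := by
      refine Prod.ext ?_ ?_
      · ext j
        simp [Prod.fst_sum, Pi.single_apply]
      · simp [Prod.snd_sum]
    rw [this, map_sum]
    simp only [Φ, g, LinearMap.sum_apply, LinearMap.smulRight_apply, LinearMap.proj_apply,
      pairComb_single_natAdd, map_smul, real_smul_eq]
  rw [hΦ, ← map_add, Prod.mk_add_mk, add_zero, zero_add, LinearEquiv.map_eq_zero_iff,
    Prod.mk_eq_zero] at q8
  obtain ⟨hα', hl⟩ := q8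
  have h6 : ∀ j, α (Fin.castAdd d j) = 0 ∧ β j = 0 := by
    intro j
    have := congrFun q6 j
    simp only [pb, LinearMap.funLeft_apply, g, pairComb_single_castAdd] at this
    have hre := congrArg Complex.re this
    have him := congrArg Complex.im this
    simp at hre him
    exact ⟨hre, him⟩
  have hα : α = 0 := by
    ext j
    refine Fin.addCases (fun j => (h6 j).1) (fun j => congrFun hα' j) j
  have hβ : β = 0 := funext fun j => (h6 j).2
  have hx0 : x0 = 0 := by
    apply e0.injective
    rw [map_zero]
    refine Prod.ext q1 ?_
    rw [q2, hα, hβ]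
    simp [pairComb]
  have hx1 : x1 = 0 := by
    apply e1.injective
    rw [map_zero]
    exact Prod.ext q3 q7
  rw [hx0, hx1, hα, hβ, hl]
  rfl

/-- In the witness, the nulled parts of both signals occupy separate dimensions at receiver `1`,
while the aligned parts arrive in the same `c` dimensions with coefficients `1` and `i`. -/
theorem exists_recvOneMap_injective {k₀ k₁ : ℕ} (h0 : N 0 + k₀ = M 0) (h1 : N 0 + k₁ = M 1)
    (hc : c ≤ N 0) (hdim : k₀ + k₁ + c = N 1) :
    ∃ θ : Channel M N × (Fin c → Fin (N 0) → ℂ), ∀ x, recvOneMap θ x = 0 → x = 0 := by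
  obtain ⟨e0⟩ : Nonempty ((Fin (M 0) → ℂ) ≃ₗ[ℂ] (Fin (N 0) → ℂ) × (Fin k₀ → ℂ)) :=
    ⟨LinearEquiv.ofFinrankEq _ _ (by simp [h0])⟩
  obtain ⟨e1⟩ : Nonempty ((Fin (M 1) → ℂ) ≃ₗ[ℂ] (Fin (N 0) → ℂ) × (Fin k₁ → ℂ)) :=
    ⟨LinearEquiv.ofFinrankEq _ _ (by simp [h1])⟩
  obtain ⟨e⟩ : Nonempty ((Fin (N 1) → ℂ) ≃ₗ[ℂ] (Fin k₀ → ℂ) × (Fin k₁ → ℂ) × (Fin c → ℂ)) :=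
    ⟨LinearEquiv.ofFinrankEq _ _ (by simp; omega)⟩
  let p : (Fin (N 0) → ℂ) →ₗ[ℂ] (Fin c → ℂ) := LinearMap.funLeft ℂ ℂ (Fin.castLE hc)
  let f : Fin c → Fin (N 0) → ℂ := fun l => Pi.single (Fin.castLE hc l) 1
  obtain ⟨L, hL00, hL01, hL10, hL11⟩ := exists_pi_fin_two_two
    (α := fun r t => (Fin (M t) → ℂ) →ₗ[ℂ] (Fin (N r) → ℂ))
    (LinearMap.fst ℂ _ _ ∘ₗ e0.toLinearMap) (LinearMap.fst ℂ _ _ ∘ₗ e1.toLinearMap)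
    (e.symm.toLinearMap ∘ₗ (LinearMap.snd ℂ _ _).prod ((0 : _ →ₗ[ℂ] (Fin k₁ → ℂ)).prod
      (p ∘ₗ LinearMap.fst ℂ _ _)) ∘ₗ e0.toLinearMap)
    (e.symm.toLinearMap ∘ₗ (0 : _ →ₗ[ℂ] (Fin k₀ → ℂ)).prod ((LinearMap.snd ℂ _ _).prod
      (Complex.I • p ∘ₗ LinearMap.fst ℂ _ _)) ∘ₗ e1.toLinearMap)
  refine ⟨(channelOfLinear L, f), ?_⟩
  rintro ⟨x0, x1, l, l'⟩ hx
  have hx00 : L 0 0 x0 = (e0 x0).1 := by rw [hL00]; rfl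
  have hx01 : L 0 1 x1 = (e1 x1).1 := by rw [hL01]; rfl
  have hx10 : L 1 0 x0 = e.symm ((e0 x0).2, 0, p (e0 x0).1) := by rw [hL10]; rfl
  have hx11 : L 1 1 x1 = e.symm (0, (e1 x1).2, Complex.I • p (e1 x1).1) := by rw [hL11]; rfl
  simp only [recvOneMap, channelOfLinear_mulVec, hx00, hx01, hx10, hx11, Prod.mk_eq_zero] at hx
  obtain ⟨q1, q2, q4⟩ := hx
  have q1 : (e0 x0).1 = ∑ i, (l i : ℂ) • f i := sub_eq_zero.1 q1
  have q2 : (e1 x1).1 = ∑ i, (l' i : ℂ) • f i := sub_eq_zero.1 q2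
  have hp : ∀ u : Fin c → ℝ, p (∑ i, (u i : ℂ) • f i) = fun i => (u i : ℂ) := by
    intro u
    ext j
    simp [p, f, LinearMap.funLeft_apply, Pi.single_apply]
  have q5 := congrArg e q4
  simp only [map_add, LinearEquiv.apply_symm_apply, map_zero, q1, q2, hp, Prod.mk_add_mk,
    Prod.mk_eq_zero, add_zero, zero_add] at q5
  obtain ⟨q6, q7, q8⟩ := q5
  have h8 : ∀ j, l j = 0 ∧ l' j = 0 := by
    intro j
    have := congrFun q8 j
    have hre := congrArg Complex.re this
    have him := congrArg Complex.im this
    simp at hre him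
    exact ⟨hre, him⟩
  have hl : l = 0 := funext fun j => (h8 j).1
  have hl' : l' = 0 := funext fun j => (h8 j).2
  have hx0 : x0 = 0 := by
    apply e0.injective
    rw [map_zero]
    exact Prod.ext (by rw [q1, hl]; simp) q6
  have hx1 : x1 = 0 := by
    apply e1.injective
    rw [map_zero]
    exact Prod.ext (by rw [q2, hl']; simp) q7
  rw [hx0, hx1, hl, hl']
  rfl

end Witness

/-! ### Generic channels -/

section Generic

variable {M N : Fin 2 → ℕ} {b d c k : ℕ}

/-- The linear-algebraic facts about a channel from which the precoders are built: `f` are the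
aligned interference directions at receiver `0`, `Th` is a coordinate system on the kernel of
`H 1 0`, and `g` prescribes the coordinates of the first-block vectors chosen there. -/
structure IsGeneric (H : Channel M N) (f : Fin c → Fin (N 0) → ℂ)
    (g : Fin (b + d) → Fin k → ℂ) (Th : Fin k → Fin (M 0) → ℂ) : Prop where
  recvZero : ∀ x, recvZeroMap (H, f, g, Th) x = 0 → x = 0
  recvOne : ∀ x, recvOneMap (H, f) x = 0 → x = 0
  indep_f : LinearIndependent ℂ f
  indep_g : LinearIndependent ℂ g
  coord : ∀ x : Fin (M 0) → ℂ, Matrix.of (H 1 0) *ᵥ x = 0 → Matrix.of Th *ᵥ x = 0 → x = 0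

/-- The auxiliary parameters `(f, g, Th)` of `IsGeneric`. -/
abbrev AuxParam (M N : Fin 2 → ℕ) (b d c k : ℕ) : Type :=
  (Fin c → Fin (N 0) → ℂ) × (Fin (b + d) → Fin k → ℂ) × (Fin k → Fin (M 0) → ℂ)

instance (M N : Fin 2 → ℕ) (b d c k : ℕ) : BorelSpace (Channel M N × AuxParam M N b d c k) :=
  Prod.borelSpace

/-- Fubini's theorem as a source of auxiliary parameters: a generic property of pairs holds, for
almost every first component, with some second component. -/
theorem ae_exists_of_ae_prod {A B : Type*} [NormedAddCommGroup A] [NormedSpace ℝ A]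
    [FiniteDimensional ℝ A] [MeasurableSpace A] [BorelSpace A] [NormedAddCommGroup B]
    [NormedSpace ℝ B] [FiniteDimensional ℝ B] [MeasurableSpace B] [BorelSpace B] (μ : Measure A)
    [μ.IsAddHaarMeasure] (p : A → B → Prop)
    (h : ∀ ν : Measure (A × B), ν.IsAddHaarMeasure → ∀ᵐ θ ∂ν, p θ.1 θ.2) :
    ∀ᵐ a ∂μ, ∃ b, p a b := by
  have : ProperSpace A := FiniteDimensional.proper ℝ A
  have : ProperSpace B := FiniteDimensional.proper ℝ B
  have key := h (μ.prod Measure.addHaar) inferInstance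
  filter_upwards [Measure.ae_ae_of_ae_prod key] with a ha
  exact ha.exists

/-- Linear independence of a family that is a linear image of the parameter is generic. -/
theorem ae_linearIndependent {Θ : Type*} [NormedAddCommGroup Θ] [NormedSpace ℝ Θ]
    [FiniteDimensional ℝ Θ] [MeasurableSpace Θ] [BorelSpace Θ] (μ : Measure Θ)
    [μ.IsAddHaarMeasure] {c n : ℕ} (h : c ≤ n) (π : Θ →ₗ[ℝ] (Fin c → Fin n → ℂ))
    (hπ : Function.Surjective π) : ∀ᵐ θ ∂μ, LinearIndependent ℂ (π θ) := by
  obtain ⟨θ₀, hθ₀⟩ := hπ fun i => Pi.single (Fin.castLE h i) 1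
  have := ae_injective_of_linear_family μ (fun θ (x : Fin c → ℂ) => ∑ i, x i • π θ i)
    (fun θ => ⟨fun x y => by simp [add_smul, Finset.sum_add_distrib],
      fun a x => by simp [Finset.smul_sum, mul_smul]⟩)
    (fun x => ⟨fun θ θ' => by simp [Finset.sum_add_distrib],
      fun a θ => by
        simp only [map_smul, Pi.smul_apply, Finset.smul_sum]
        exact Finset.sum_congr rfl fun i _ => smul_comm _ _ _⟩)
    θ₀ (by
      intro x hx
      rw [hθ₀] at hx
      ext i
      have := congrFun hx (Fin.castLE h i)
      simpa [Pi.single_apply] using this)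
  filter_upwards [this] with θ hθ
  rw [Fintype.linearIndependent_iff]
  intro x hx i
  exact congrFun (hθ x hx) i

/-- The equations `hdim` and `hdim'` say that the desired streams and the aligned interference fill
the `2 * N 0` and the `2 * N 1` real dimensions of the two receivers. -/
theorem ae_exists_isGeneric {k₁ l₀ l₁ : ℕ} (h0 : N 1 + k = M 0) (h1 : N 1 + k₁ = M 1)
    (hbd : b + d ≤ k) (hdim : 2 * b + d + 2 * k₁ + c = 2 * N 0)
    (h0' : N 0 + l₀ = M 0) (h1' : N 0 + l₁ = M 1)
    (hc : c ≤ N 0) (hdim' : l₀ + l₁ + c = N 1) :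
    ∀ᵐ H ∂(volume : Measure (Channel M N)), ∃ f : Fin c → Fin (N 0) → ℂ,
      ∃ g : Fin (b + d) → Fin k → ℂ, ∃ Th : Fin k → Fin (M 0) → ℂ, IsGeneric H f g Th := by
  suffices h : ∀ᵐ H ∂(volume : Measure (Channel M N)), ∃ q : AuxParam M N b d c k,
      IsGeneric H q.1 q.2.1 q.2.2 by
    filter_upwards [h] with H hH
    obtain ⟨⟨f, g, Th⟩, h⟩ := hH
    exact ⟨f, g, Th, h⟩
  refine ae_exists_of_ae_prod _ _ fun μ hμ => ?_
  obtain ⟨θ₀, hθ₀⟩ := exists_recvZeroMap_injective (M := M) (N := N) h0 h1 hbd hdim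
  obtain ⟨θ₁, hθ₁⟩ := exists_recvOneMap_injective (M := M) (N := N) h0' h1' hc hdim'
  have a1 := ae_injective_of_linear_family μ (fun θ => recvZeroMap θ)
    isLinearMap_recvZeroMap isLinearMap_recvZeroMap_left θ₀ hθ₀
  have a2 := ae_injective_of_linear_family μ (fun θ x => recvOneMap (θ.1, θ.2.1) x)
    (fun θ => isLinearMap_recvOneMap _)
    (fun x => ⟨fun θ θ' => (isLinearMap_recvOneMap_left x).map_add (θ.1, θ.2.1) (θ'.1, θ'.2.1),
      fun a θ => (isLinearMap_recvOneMap_left x).map_smul a (θ.1, θ.2.1)⟩)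
    (θ₁.1, θ₁.2, 0) hθ₁
  have a3 := ae_linearIndependent μ hc
    (LinearMap.fst ℝ _ _ ∘ₗ LinearMap.snd ℝ (Channel M N) (AuxParam M N b d c k)) fun f => ⟨(0, f, 0), rfl⟩
  have a4 := ae_linearIndependent μ hbd
    (LinearMap.fst ℝ _ _ ∘ₗ LinearMap.snd ℝ _ _ ∘ₗ LinearMap.snd ℝ (Channel M N) (AuxParam M N b d c k))
    fun g => ⟨(0, 0, g, 0), rfl⟩
  let e0 : (Fin (M 0) → ℂ) ≃ₗ[ℂ] (Fin (N 1) → ℂ) × (Fin k → ℂ) :=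
    LinearEquiv.ofFinrankEq _ _ (by simp [h0])
  let T : (Fin (M 0) → ℂ) →ₗ[ℂ] (Fin k → ℂ) := LinearMap.snd ℂ _ _ ∘ₗ e0.toLinearMap
  let L : ∀ r t : Fin 2, (Fin (M t) → ℂ) →ₗ[ℂ] (Fin (N r) → ℂ) := fun r t => match r, t with
    | 1, 0 => LinearMap.fst ℂ _ _ ∘ₗ e0.toLinearMap
    | _, _ => 0
  have a5 := ae_injective_of_linear_family μ
    (fun θ (x : Fin (M 0) → ℂ) => (Matrix.of (θ.1 1 0) *ᵥ x, Matrix.of θ.2.2.2 *ᵥ x))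
    (fun θ => ⟨fun x y => by simp only [Matrix.mulVec_add, Prod.mk_add_mk],
      fun a x => by simp only [Matrix.mulVec_smul, Prod.smul_mk]⟩)
    (fun x => ⟨fun θ θ' => by
        simp only [Prod.fst_add, Prod.snd_add, Pi.add_apply, of_add_mulVec, Prod.mk_add_mk],
      fun a θ => by
        simp only [Prod.smul_fst, Prod.smul_snd, Pi.smul_apply, real_smul_eq, of_smul_mulVec,
          Prod.smul_mk]⟩)
    (channelOfLinear L, 0, 0, LinearMap.toMatrix' T) (by
      intro x hx
      rw [Prod.mk_eq_zero] at hx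
      dsimp only at hx
      rw [channelOfLinear_mulVec] at hx
      have h2 : T x = 0 := by
        rw [← LinearMap.toMatrix'_mulVec T x]
        exact hx.2
      exact (LinearEquiv.map_eq_zero_iff e0).1 (Prod.ext hx.1 h2))
  filter_upwards [a1, a2, a3, a4, a5] with θ c1 c2 c3 c4 c5
  exact ⟨c1, c2, c3, c4, fun x hx hx' => c5 x (Prod.mk_eq_zero.2 ⟨hx, hx'⟩)⟩

end Generic

/-! ### The precoders -/

section Build

variable {M N : Fin 2 → ℕ} {b d c k k₁ l₀ l₁ : ℕ}

/-- The block lengths of the scheme.  Nothing meant for receiver `0` is aligned at receiver `1`,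
whose `2 * N 1` real dimensions are exhausted by the streams it desires. -/
def alignmentLengths (b d c k₁ l₀ l₁ : ℕ) : BlockLengths where
  len₁ r t := match r, t with
    | 0, 0 => b + d
    | 0, 1 => k₁
    | 1, 0 => l₀
    | 1, 1 => l₁
  len₂ r t := match r, t with
    | 0, 0 => b
    | 0, 1 => k₁
    | 1, 0 => l₀
    | 1, 1 => l₁
  len₃ r _ := match r with
    | 0 => 0
    | 1 => c

/-- The precoders with the given first and third blocks. -/
noncomputable def alignmentPrecoders (v₀₀ : Fin (b + d) → Fin (M 0) → ℂ)
    (v₀₁ : Fin k₁ → Fin (M 1) → ℂ) (v₁₀ : Fin l₀ → Fin (M 0) → ℂ) (v₁₁ : Fin l₁ → Fin (M 1) → ℂ)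
    (u₀ : Fin c → Fin (M 0) → ℂ) (u₁ : Fin c → Fin (M 1) → ℂ) :
    Precoders M (alignmentLengths b d c k₁ l₀ l₁) where
  v r t := match r, t with
    | 0, 0 => v₀₀
    | 0, 1 => v₀₁
    | 1, 0 => v₁₀
    | 1, 1 => v₁₁
  w r t := match r, t with
    | 0, 0 => fun j => Complex.I • v₀₀ (Fin.castAdd d j)
    | 0, 1 => fun j => Complex.I • v₀₁ j
    | 1, 0 => fun j => Complex.I • v₁₀ j
    | 1, 1 => fun j => Complex.I • v₁₁ j
  u r t := match r, t with
    | 0, _ => fun j => j.elim0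
    | 1, 0 => u₀
    | 1, 1 => u₁

/-- A real combination of the received directions, sorted by transmitters. -/
theorem Precoders.sum_received {L : BlockLengths} (p : Precoders M L) (H : Channel M N) (r : Fin 2)
    (G : ((Σ t, L.Stream r t) ⊕ Fin (L.len₃ r.rev 0)) → ℝ) :
    ∑ i, G i • p.received H r i =
      ∑ t, Matrix.of (H r t) *ᵥ (∑ j, (G (.inl ⟨t, .inl j⟩) : ℂ) • p.v r t j +
        ∑ j, (G (.inl ⟨t, .inr (.inl j)⟩) : ℂ) • p.w r t j +
        ∑ j, (G (.inl ⟨t, .inr (.inr j)⟩) : ℂ) • p.u r t j) +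
      Matrix.of (H r 0) *ᵥ ∑ j, (G (.inr j) : ℂ) • p.u r.rev 0 j := by
  rw [Fintype.sum_sum_type, Fintype.sum_sigma]
  simp only [Fintype.sum_sum_type, Precoders.received, Sum.elim_inl, Sum.elim_inr, Precoders.vec,
    real_smul_eq, Matrix.mulVec_add, Matrix.mulVec_sum, Matrix.mulVec_smul, add_assoc]

theorem exists_kernel_family (H : Channel M N) (r t : Fin 2)
    (hs : Function.Surjective fun x : Fin (M t) → ℂ => Matrix.of (H r t) *ᵥ x) {k : ℕ}
    (h : N r + k = M t) : ∃ v : Fin k → Fin (M t) → ℂ, LinearIndependent ℂ v ∧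
      ∀ j, Matrix.of (H r t) *ᵥ v j = 0 := by
  let T := (Matrix.of (H r t)).mulVecLin
  have h1 := T.finrank_range_add_finrank_ker
  have h2 : LinearMap.range T = ⊤ := LinearMap.range_eq_top.2 hs
  rw [h2] at h1
  simp only [finrank_top, Module.finrank_fintype_fun_eq_card, Fintype.card_fin] at h1
  have h3 : Module.finrank ℂ (LinearMap.ker T) = k := by omega
  let B := Module.finBasisOfFinrankEq ℂ _ h3
  refine ⟨fun j => B j, ?_, fun j => (B j).2⟩
  exact B.linearIndependent.map' (LinearMap.ker T).subtype (Submodule.ker_subtype _)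

theorem eq_zero_of_sum_pair {n m : ℕ} {v : Fin n → Fin m → ℂ} (hv : LinearIndependent ℂ v)
    (α β : Fin n → ℝ)
    (h : ∑ j, (α j : ℂ) • v j + ∑ j, (β j : ℂ) • (Complex.I • v j) = 0) :
    ∀ j, α j = 0 ∧ β j = 0 := by
  have h1 : ∑ j, ((α j : ℂ) + β j * Complex.I) • v j = 0 := by
    rw [← h, ← Finset.sum_add_distrib]
    simp only [add_smul, smul_smul]
  intro j
  have h2 := Fintype.linearIndependent_iff.1 hv _ h1 j
  have hre := congrArg Complex.re h2
  have him := congrArg Complex.im h2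
  simp at hre him
  exact ⟨hre, him⟩

/-- First blocks are bases of kernels, except for `v 0 0`, which has the coordinates `g` there;
third blocks are preimages of the directions `f` at receiver `0`. -/
theorem exists_isAlignmentCancelation {H : Channel M N} {f : Fin c → Fin (N 0) → ℂ}
    {g : Fin (b + d) → Fin k → ℂ} {Th : Fin k → Fin (M 0) → ℂ} (hH : IsGeneric H f g Th)
    (h0 : N 1 + k = M 0) (h1 : N 1 + k₁ = M 1) (h0' : N 0 + l₀ = M 0) (h1' : N 0 + l₁ = M 1)
    (hs : ∀ r t, Function.Surjective fun x : Fin (M t) → ℂ => Matrix.of (H r t) *ᵥ x) :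
    ∃ p : Precoders M (alignmentLengths b d c k₁ l₀ l₁), p.IsAlignmentCancelation H := by
  obtain ⟨v₀₁, i₀₁, n₀₁⟩ := exists_kernel_family H 1 1 (hs 1 1) h1
  obtain ⟨v₁₀, i₁₀, n₁₀⟩ := exists_kernel_family H 0 0 (hs 0 0) h0'
  obtain ⟨v₁₁, i₁₁, n₁₁⟩ := exists_kernel_family H 0 1 (hs 0 1) h1'
  choose u₀ hu₀ using fun j => hs 0 0 (f j)
  choose u₁ hu₁ using fun j => hs 0 1 (f j)
  have hsurj : Function.Surjective
      ((Matrix.of (H 1 0)).mulVecLin.prod (Matrix.of Th).mulVecLin) := by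
    rw [← LinearMap.injective_iff_surjective_of_finrank_eq_finrank (by simp [h0])]
    rw [← LinearMap.ker_eq_bot, LinearMap.ker_eq_bot']
    intro x hx
    exact hH.coord x (congrArg Prod.fst hx) (congrArg Prod.snd hx)
  choose v₀₀ hv₀₀ using fun j => hsurj (0, g j)
  have n₀₀ : ∀ j, Matrix.of (H 1 0) *ᵥ v₀₀ j = 0 := fun j => congrArg Prod.fst (hv₀₀ j)
  have t₀₀ : ∀ j, Matrix.of Th *ᵥ v₀₀ j = g j := fun j => congrArg Prod.snd (hv₀₀ j)
  have i₀₀ : LinearIndependent ℂ v₀₀ := by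
    refine LinearIndependent.of_comp (Matrix.of Th).mulVecLin ?_
    convert hH.indep_g using 1
    exact funext t₀₀
  have hle : ∀ r t, (alignmentLengths b d c k₁ l₀ l₁).len₂ r t ≤
      (alignmentLengths b d c k₁ l₀ l₁).len₁ r t := by
    rw [Fin.forall_fin_two]
    constructor <;> rw [Fin.forall_fin_two]
    · exact ⟨Nat.le_add_right b d, le_refl k₁⟩
    · exact ⟨le_refl l₀, le_refl l₁⟩
  refine ⟨alignmentPrecoders v₀₀ v₀₁ v₁₀ v₁₁ u₀ u₁, ?_, ?_, hle, ?_, fun r => rfl, ?_, ?_, ?_⟩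
  · rw [Fin.forall_fin_two]
    constructor <;> rw [Fin.forall_fin_two]
    · exact ⟨i₀₀, i₀₁⟩
    · exact ⟨i₁₀, i₁₁⟩
  · rw [Fin.forall_fin_two]
    constructor <;> rw [Fin.forall_fin_two]
    · exact ⟨n₀₀, n₀₁⟩
    · exact ⟨n₁₀, n₁₁⟩
  · rw [Fin.forall_fin_two]
    constructor <;> rw [Fin.forall_fin_two]
    · exact ⟨fun j => rfl, fun j => rfl⟩
    · exact ⟨fun j => rfl, fun j => rfl⟩
  · rw [Fin.forall_fin_two]
    refine ⟨linearIndependent_empty_type (ι := Fin 0), ?_⟩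
    have : (fun j : Fin c => Matrix.of (H 0 0) *ᵥ u₀ j) = f := funext hu₀
    change LinearIndependent ℂ fun j : Fin c => Matrix.of (H 0 0) *ᵥ u₀ j
    rw [this]
    exact hH.indep_f
  · rw [Fin.forall_fin_two]
    refine ⟨fun j => (show Fin 0 from j).elim0, fun j => ?_⟩
    change Submodule.span ℝ {Matrix.of (H 0 1) *ᵥ u₁ j} =
      Submodule.span ℝ {Matrix.of (H 0 0) *ᵥ u₀ j}
    rw [show Matrix.of (H 0 1) *ᵥ u₁ j = f j from hu₁ j,
      show Matrix.of (H 0 0) *ᵥ u₀ j = f j from hu₀ j]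
  · rw [Fin.forall_fin_two]
    constructor
    · rw [Fintype.linearIndependent_iff]
      intro G hG
      rw [Precoders.sum_received] at hG
      let α : Fin (b + d) → ℝ := fun j => G (.inl ⟨0, .inl j⟩)
      let β : Fin b → ℝ := fun j => G (.inl ⟨0, .inr (.inl j)⟩)
      let α' : Fin k₁ → ℝ := fun j => G (.inl ⟨1, .inl j⟩)
      let β' : Fin k₁ → ℝ := fun j => G (.inl ⟨1, .inr (.inl j)⟩)
      let l : Fin c → ℝ := fun j => G (.inr j)
      let x₁ := ∑ j, (α' j : ℂ) • v₀₁ j + ∑ j, (β' j : ℂ) • (Complex.I • v₀₁ j)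
      have hG' : Matrix.of (H 0 0) *ᵥ pairComb v₀₀ α β + Matrix.of (H 0 1) *ᵥ x₁ +
          ∑ j, (l j : ℂ) • f j = 0 := by
        rw [Fin.sum_univ_two] at hG
        have e1 : pairComb v₀₀ α β = ∑ j, (α j : ℂ) • v₀₀ j +
            ∑ j, (β j : ℂ) • (Complex.I • v₀₀ (Fin.castAdd d j)) + 0 := by
          simp only [pairComb, mul_smul, add_zero]
        have e2 : x₁ = x₁ + 0 := (add_zero _).symm
        have e3 : ∑ j, (l j : ℂ) • f j = Matrix.of (H 0 0) *ᵥ ∑ j, (l j : ℂ) • u₀ j := by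
          simp only [Matrix.mulVec_sum, Matrix.mulVec_smul]
          exact Finset.sum_congr rfl fun j _ => by rw [← hu₀ j]
        rw [e1, e2, e3]
        exact hG
      have hz := hH.recvZero (pairComb v₀₀ α β, x₁, α, β, l) (by
        refine Prod.ext ?_ (Prod.ext ?_ (Prod.ext ?_ hG'))
        · change (Matrix.of (H 1 0)).mulVecLin (pairComb v₀₀ α β) = 0
          rw [map_pairComb]
          simp [n₀₀, pairComb]
        · change (Matrix.of Th).mulVecLin (pairComb v₀₀ α β) - pairComb g α β = 0
          rw [map_pairComb]
          simp only [Matrix.mulVecLin_apply, t₀₀]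
          exact sub_self _
        · change Matrix.of (H 1 1) *ᵥ x₁ = 0
          simp [x₁, Matrix.mulVec_add, Matrix.mulVec_sum, Matrix.mulVec_smul, n₀₁])
      simp only [Prod.mk_eq_zero] at hz
      obtain ⟨-, hx₁, hα, hβ, hl⟩ := hz
      have h2 := eq_zero_of_sum_pair i₀₁ α' β' hx₁
      rintro (⟨t, s⟩ | j)
      · revert s
        revert t
        rw [Fin.forall_fin_two]
        constructor
        · rintro (j | j | j)
          · exact congrFun hα j
          · exact congrFun hβ j
          · exact (show Fin 0 from j).elim0
        · rintro (j | j | j)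
          · exact (h2 j).1
          · exact (h2 j).2
          · exact (show Fin 0 from j).elim0
      · exact congrFun hl j
    · rw [Fintype.linearIndependent_iff]
      intro G hG
      rw [Precoders.sum_received] at hG
      let α : Fin l₀ → ℝ := fun j => G (.inl ⟨0, .inl j⟩)
      let β : Fin l₀ → ℝ := fun j => G (.inl ⟨0, .inr (.inl j)⟩)
      let l : Fin c → ℝ := fun j => G (.inl ⟨0, .inr (.inr j)⟩)
      let α' : Fin l₁ → ℝ := fun j => G (.inl ⟨1, .inl j⟩)
      let β' : Fin l₁ → ℝ := fun j => G (.inl ⟨1, .inr (.inl j)⟩)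
      let l' : Fin c → ℝ := fun j => G (.inl ⟨1, .inr (.inr j)⟩)
      let x₀ := ∑ j, (α j : ℂ) • v₁₀ j + ∑ j, (β j : ℂ) • (Complex.I • v₁₀ j) +
        ∑ j, (l j : ℂ) • u₀ j
      let x₁ := ∑ j, (α' j : ℂ) • v₁₁ j + ∑ j, (β' j : ℂ) • (Complex.I • v₁₁ j) +
        ∑ j, (l' j : ℂ) • u₁ j
      have hG' : Matrix.of (H 1 0) *ᵥ x₀ + Matrix.of (H 1 1) *ᵥ x₁ = 0 := by
        rw [Fin.sum_univ_two] at hG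
        have hz : Matrix.of (H 1 0) *ᵥ (0 : Fin (M 0) → ℂ) = 0 := Matrix.mulVec_zero _
        rw [← add_zero (Matrix.of (H 1 0) *ᵥ x₀ + Matrix.of (H 1 1) *ᵥ x₁)]
        nth_rewrite 1 [← hz]
        exact hG
      have hz := hH.recvOne (x₀, x₁, l, l') (by
        refine Prod.ext ?_ (Prod.ext ?_ hG')
        · change Matrix.of (H 0 0) *ᵥ x₀ - ∑ j, (l j : ℂ) • f j = 0
          simp only at hu₀
          simp [x₀, Matrix.mulVec_add, Matrix.mulVec_sum, Matrix.mulVec_smul, n₁₀, hu₀]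
        · change Matrix.of (H 0 1) *ᵥ x₁ - ∑ j, (l' j : ℂ) • f j = 0
          simp only at hu₁
          simp [x₁, Matrix.mulVec_add, Matrix.mulVec_sum, Matrix.mulVec_smul, n₁₁, hu₁])
      simp only [Prod.mk_eq_zero] at hz
      obtain ⟨hx₀, hx₁, hl, hl'⟩ := hz
      have h2 := eq_zero_of_sum_pair i₁₀ α β (by simpa [x₀, hl] using hx₀)
      have h3 := eq_zero_of_sum_pair i₁₁ α' β' (by simpa [x₁, hl'] using hx₁)
      rintro (⟨t, s⟩ | j)
      · revert s
        revert t
        rw [Fin.forall_fin_two]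
        constructor
        · rintro (j | j | j)
          · exact (h2 j).1
          · exact (h2 j).2
          · exact congrFun hl j
        · rintro (j | j | j)
          · exact (h3 j).1
          · exact (h3 j).2
          · exact congrFun hl' j
      · exact (show Fin 0 from j).elim0

end Build

/-! ### Codes with large Hamming distance -/

section Codes

/-- A Hamming ball is covered by the words that differ from the centre in a given set of positions,
over all sets of at most `d` positions. -/
theorem card_hammingBall_le {n q d : ℕ} (hq : 0 < q) (y : Fin n → Fin q) :
    (Finset.univ.filter fun x : Fin n → Fin q => hammingDist x y ≤ d).card ≤ 2 ^ n * q ^ d := by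
  let A : Finset (Fin n) → Finset (Fin n → Fin q) := fun T =>
    Fintype.piFinset fun i => if i ∈ T then Finset.univ else {y i}
  have hsub : (Finset.univ.filter fun x : Fin n → Fin q => hammingDist x y ≤ d) ⊆
      (Finset.univ.filter fun T : Finset (Fin n) => T.card ≤ d).biUnion A := by
    intro x hx
    rw [Finset.mem_biUnion]
    refine ⟨Finset.univ.filter fun i => x i ≠ y i, by simpa [hammingDist] using hx, ?_⟩
    rw [Fintype.mem_piFinset]
    intro i
    by_cases h : x i = y i <;> simp [h]
  refine (Finset.card_le_card hsub).trans (Finset.card_biUnion_le.trans ?_)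
  have h1 : ∀ T ∈ Finset.univ.filter fun T : Finset (Fin n) => T.card ≤ d,
      (A T).card ≤ q ^ d := by
    intro T hT
    have hT' : T.card ≤ d := by simpa using hT
    have : (A T).card = q ^ T.card := by
      simp only [A, Fintype.card_piFinset]
      rw [← Finset.prod_const, ← Finset.prod_subset (Finset.subset_univ T)]
      · exact Finset.prod_congr rfl fun i hi => by simp [hi]
      · intro i _ hi
        simp [hi]
    rw [this]
    exact Nat.pow_le_pow_right hq hT'
  refine (Finset.sum_le_card_nsmul _ _ _ h1).trans ?_
  rw [smul_eq_mul]
  refine Nat.mul_le_mul_right _ ((Finset.card_filter_le _ _).trans ?_)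
  simp

/-- The Gilbert–Varshamov bound: a maximal code of minimum distance greater than `d` is so large
that the Hamming balls of radius `d` around its words cover everything. -/
theorem exists_code_hammingDist (n q d : ℕ) (hq : 0 < q) :
    ∃ (K : ℕ) (C : Fin K → Fin n → Fin q), (∀ i j, i ≠ j → d < hammingDist (C i) (C j)) ∧
      q ^ n ≤ K * (2 ^ n * q ^ d) := by
  classical
  let good : Finset (Fin n → Fin q) → Prop := fun S =>
    ∀ x ∈ S, ∀ y ∈ S, x ≠ y → d < hammingDist x y
  obtain ⟨S, hS, hmax⟩ := Finset.exists_max_image (Finset.univ.filter good) Finset.card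
    ⟨∅, by simp [good]⟩
  have hS' : good S := by simpa using hS
  have hcover : (Finset.univ : Finset (Fin n → Fin q)) ⊆
      S.biUnion fun y => Finset.univ.filter fun x => hammingDist x y ≤ d := by
    intro x _
    by_contra hx
    simp only [Finset.mem_biUnion, Finset.mem_filter, Finset.mem_univ, true_and, not_exists,
      not_and, not_le] at hx
    have hxS : x ∉ S := fun h => by simpa using hx x h
    have hg : good (insert x S) := by
      intro a ha b hb hab
      rcases Finset.mem_insert.1 ha with rfl | haS
      · rcases Finset.mem_insert.1 hb with rfl | hbS
        · exact absurd rfl hab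
        · exact hx b hbS
      · rcases Finset.mem_insert.1 hb with rfl | hbS
        · rw [hammingDist_comm]
          exact hx a haS
        · exact hS' a haS b hbS hab
    have := hmax (insert x S) (by simpa using hg)
    rw [Finset.card_insert_of_notMem hxS] at this
    omega
  refine ⟨S.card, fun i => (S.equivFin.symm i : Fin n → Fin q), ?_, ?_⟩
  · intro i j hij
    refine hS' _ (S.equivFin.symm i).2 _ (S.equivFin.symm j).2 fun h => hij ?_
    exact S.equivFin.symm.injective (Subtype.ext h)
  · have h1 := Finset.card_le_card hcover
    rw [Finset.card_univ, Fintype.card_fun, Fintype.card_fin, Fintype.card_fin] at h1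
    refine h1.trans (Finset.card_biUnion_le.trans ?_)
    have := Finset.sum_le_card_nsmul S _ _ fun y _ => card_hammingBall_le (d := d) hq y
    simpa using this

/-- Bounded-distance decoding.  The hard decisions `y` are integers, possibly outside of the
alphabet. -/
theorem exists_decoder {n q e K : ℕ} (hK : 0 < K) (C : Fin K → Fin n → Fin q)
    (hC : ∀ i j, i ≠ j → 2 * e < hammingDist (C i) (C j)) :
    ∃ δ : (Fin n → ℤ) → Fin K, ∀ y m,
      (Finset.univ.filter fun τ => y τ ≠ ((C m τ : ℕ) : ℤ)).card ≤ e → δ y = m := by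
  classical
  let near : (Fin n → ℤ) → Fin K → Prop := fun y m =>
    (Finset.univ.filter fun τ => y τ ≠ ((C m τ : ℕ) : ℤ)).card ≤ e
  refine ⟨fun y => if h : ∃ m, near y m then h.choose else ⟨0, hK⟩, fun y m hm => ?_⟩
  have hex : ∃ m, near y m := ⟨m, hm⟩
  have h1 : near y hex.choose := hex.choose_spec
  dsimp only
  rw [dif_pos hex]
  by_contra hne
  have h2 := hC _ _ hne
  have h3 : hammingDist (C hex.choose) (C m) ≤ e + e := by
    refine le_trans ?_ (Nat.add_le_add h1 hm)
    refine le_trans (Finset.card_le_card ?_) (Finset.card_union_le _ _)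
    intro τ hτ
    simp only [Finset.mem_union, Finset.mem_filter, Finset.mem_univ, true_and] at hτ ⊢
    by_contra hcon
    push Not at hcon
    apply hτ
    have := hcon.1.symm.trans hcon.2
    exact Fin.ext (by exact_mod_cast this)
  omega

end Codes

/-! ### Zero forcing -/

section ZeroForcing

variable {M N : Fin 2 → ℕ} {L : BlockLengths}

/-- A real functional that isolates one desired stream: it vanishes on all other desired streams and
on the interference, which is either nulled or lies on an aligned real line. -/
theorem Precoders.IsAlignmentCancelation.exists_zeroForcing {p : Precoders M L} {H : Channel M N}
    (hp : p.IsAlignmentCancelation H) (r t : Fin 2) (s : L.Stream r t) :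
    ∃ φ : (Fin (N r) → ℂ) →ₗ[ℝ] ℝ, φ (Matrix.of (H r t) *ᵥ p.vec r t s) = 1 ∧
      (∀ s', s' ≠ s → φ (Matrix.of (H r t) *ᵥ p.vec r t s') = 0) ∧
      (∀ t', t' ≠ t → ∀ s', φ (Matrix.of (H r t') *ᵥ p.vec r t' s') = 0) ∧
      ∀ t' s', φ (Matrix.of (H r t') *ᵥ p.vec r.rev t' s') = 0 := by
  classical
  obtain ⟨φ, hφ⟩ : ∃ φ : (Fin (N r) → ℂ) →ₗ[ℝ] ℝ,
      ∀ i, φ (p.received H r i) = if i = .inl ⟨t, s⟩ then 1 else 0 := by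
    have hli := hp.indep_received r
    obtain ⟨g, hg⟩ := (Finsupp.linearCombination ℝ (p.received H r)).exists_leftInverse_of_injective
      (LinearMap.ker_eq_bot.2 hli)
    refine ⟨Finsupp.lapply (.inl ⟨t, s⟩) ∘ₗ g, fun i => ?_⟩
    have h1 := LinearMap.congr_fun hg (Finsupp.single i 1)
    rw [LinearMap.comp_apply, Finsupp.linearCombination_single, one_smul, LinearMap.id_apply] at h1
    rw [LinearMap.comp_apply, h1, Finsupp.lapply_apply, Finsupp.single_apply]
  have hu : ∀ k, φ (Matrix.of (H r 0) *ᵥ p.u r.rev 0 k) = 0 := fun k => by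
    have := hφ (.inr k)
    simpa [Precoders.received] using this
  have hn : ∀ t' k, Matrix.of (H r t') *ᵥ p.v r.rev t' k = 0 := fun t' k => by
    have := hp.null_v r.rev t' k
    rwa [Fin.rev_rev] at this
  refine ⟨φ, ?_, ?_, ?_, ?_⟩
  · have := hφ (.inl ⟨t, s⟩)
    simpa [Precoders.received] using this
  · intro s' hs'
    have := hφ (.inl ⟨t, s'⟩)
    simpa [Precoders.received, hs'] using this
  · intro t' ht' s'
    have := hφ (.inl ⟨t', s'⟩)
    simpa [Precoders.received, ht'] using this
  · intro t' s'
    rcases s' with k | k | k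
    · change φ (Matrix.of (H r t') *ᵥ p.v r.rev t' k) = 0
      rw [hn, map_zero]
    · change φ (Matrix.of (H r t') *ᵥ p.w r.rev t' k) = 0
      rw [hp.w_eq, Matrix.mulVec_smul, hn, smul_zero, map_zero]
    · change φ (Matrix.of (H r t') *ᵥ p.u r.rev t' k) = 0
      revert k
      revert t'
      rw [Fin.forall_fin_two]
      refine ⟨hu, fun k => ?_⟩
      have h1 := hp.align r.rev k
      rw [Fin.rev_rev] at h1
      have h2 : Matrix.of (H r 1) *ᵥ p.u r.rev 1 k ∈
          Submodule.span ℝ {Matrix.of (H r 0) *ᵥ p.u r.rev 0 (Fin.cast (hp.len_eq r.rev) k)} := by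
        rw [← h1]
        exact Submodule.mem_span_singleton_self _
      obtain ⟨a, ha⟩ := Submodule.mem_span_singleton.1 h2
      rw [← ha, map_smul, hu, smul_zero]

end ZeroForcing

/-! ### Coding over the separated streams -/

section Noise

instance (N : Fin 2 → ℕ) (n : ℕ) : IsProbabilityMeasure (noiseLaw N n) := by
  unfold noiseLaw; infer_instance

open Classical in
/-- Union bound for the number of channel uses whose noise lies in a bad set. -/
theorem noiseLaw_lt_card_le (N : Fin 2 → ℕ) (n : ℕ) (r : Fin 2) (B : Set (Fin (N r) → ℂ)) (e : ℕ) :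
    (noiseLaw N n).real {z | e < (Finset.univ.filter fun τ => z r τ ∈ B).card} ≤
      2 ^ n * (Measure.pi fun _ : Fin (N r) => complexGaussian 1).real B ^ (e + 1) := by
  let μ := Measure.pi fun _ : Fin (N r) => complexGaussian 1
  let A : Finset (Fin n) → Set ((r : Fin 2) → Fin n → Fin (N r) → ℂ) := fun T =>
    {z | ∀ τ ∈ T, z r τ ∈ B}
  have hA : ∀ T, (noiseLaw N n).real (A T) = μ.real B ^ T.card := by
    intro T
    have h1 : A T = Set.pi Set.univ (Function.update (fun _ => Set.univ) r
        (Set.pi Set.univ fun τ => if τ ∈ T then B else Set.univ)) := by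
      ext z
      constructor
      · intro hz r' _
        by_cases hr : r' = r
        · subst hr
          rw [Function.update_self]
          intro τ _
          dsimp only
          split_ifs with h
          · exact hz τ h
          · trivial
        · rw [Function.update_of_ne hr]
          trivial
      · intro hz τ hτ
        have := hz r trivial
        rw [Function.update_self] at this
        have := this τ trivial
        simpa [hτ] using this
    rw [measureReal_def, h1, noiseLaw, Measure.pi_pi, ENNReal.toReal_prod,
      Finset.prod_eq_single r]
    · rw [Function.update_self, Measure.pi_pi, ENNReal.toReal_prod]
      rw [← Finset.prod_const, ← Finset.prod_subset (Finset.subset_univ T)]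
      · exact Finset.prod_congr rfl fun i hi => by simp [hi, μ, measureReal_def]
      · intro i _ hi
        simp [hi]
    · intro r' _ hr
      rw [Function.update_of_ne hr]
      simp
    · simp
  have hsub : {z : (r : Fin 2) → Fin n → Fin (N r) → ℂ |
      e < (Finset.univ.filter fun τ => z r τ ∈ B).card} ⊆
      ⋃ T ∈ (Finset.univ : Finset (Fin n)).powersetCard (e + 1), A T := by
    intro z hz
    obtain ⟨T, hT, hcard⟩ := Finset.exists_subset_card_eq (Nat.succ_le_of_lt hz)
    simp only [Set.mem_iUnion, Finset.mem_powersetCard, exists_prop]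
    exact ⟨T, ⟨Finset.subset_univ _, hcard⟩, fun τ hτ => by simpa using hT hτ⟩
  refine (measureReal_mono hsub (measure_ne_top _ _)).trans ((measureReal_biUnion_finset_le _ _).trans ?_)
  have h2 : ∀ T ∈ (Finset.univ : Finset (Fin n)).powersetCard (e + 1),
      (noiseLaw N n).real (A T) = μ.real B ^ (e + 1) := fun T hT => by
    rw [hA, (Finset.mem_powersetCard.1 hT).2]
  rw [Finset.sum_congr rfl h2, Finset.sum_const, nsmul_eq_mul]
  refine mul_le_mul_of_nonneg_right ?_ (by positivity)
  have h3 : ((Finset.univ : Finset (Fin n)).powersetCard (e + 1)).card ≤ 2 ^ n := by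
    rw [Finset.card_powersetCard, Finset.card_univ, Fintype.card_fin]
    exact Nat.choose_le_two_pow _ _
  exact_mod_cast h3

theorem tendsto_measureReal_abs_ge {E : Type*} [MeasurableSpace E] (μ : Measure E)
    [IsFiniteMeasure μ] (φ : E → ℝ) (hφ : Measurable φ) :
    Tendsto (fun m : ℕ => μ.real {z | (m : ℝ) ≤ |φ z|}) atTop (𝓝 0) := by
  have h1 := tendsto_measure_iInter_atTop (μ := μ) (s := fun m : ℕ => {z | (m : ℝ) ≤ |φ z|})
    (fun m => (measurableSet_le measurable_const hφ.abs).nullMeasurableSet)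
    (fun m m' h z (hz : (m' : ℝ) ≤ |φ z|) => show (m : ℝ) ≤ |φ z| from
      le_trans (by exact_mod_cast h) hz)
    ⟨0, measure_ne_top _ _⟩
  have h2 : (⋂ m : ℕ, {z | (m : ℝ) ≤ |φ z|}) = ∅ := by
    ext z
    simp only [Set.mem_iInter, Set.mem_ofPred_eq, Set.mem_empty_iff_false, iff_false, not_forall,
      not_le]
    exact exists_nat_gt _
  rw [h2, measure_empty] at h1
  have := (ENNReal.tendsto_toReal ENNReal.zero_ne_top).comp h1
  simpa [measureReal_def, Function.comp_def] using this

end Noise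

section Coding

variable {M N : Fin 2 → ℕ} {L : BlockLengths}

/-- The power of a transmitted vector is at most a constant times the square of the largest
symbol. -/
theorem exists_power_constant (p : Precoders M L) : ∃ Q : ℝ, 0 < Q ∧
    ∀ t (x : (r : Fin 2) → L.Stream r t → ℝ) (A : ℝ), (∀ r s, |x r s| ≤ A) →
      ∑ i, ‖(∑ r, ∑ s, x r s • p.vec r t s) i‖ ^ 2 ≤ Q * A ^ 2 := by
  let Q : Fin 2 → ℝ := fun t => ∑ i, (∑ r, ∑ s, ‖p.vec r t s i‖) ^ 2
  have hQ : ∀ t, 0 ≤ Q t := fun t => Finset.sum_nonneg fun i _ => sq_nonneg _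
  refine ⟨∑ t, Q t + 1, by have := Finset.sum_nonneg fun t (_ : t ∈ Finset.univ) => hQ t; linarith,
    fun t x A hx => ?_⟩
  have h1 : ∑ i, ‖(∑ r, ∑ s, x r s • p.vec r t s) i‖ ^ 2 ≤ Q t * A ^ 2 := by
    rw [Finset.sum_mul]
    refine Finset.sum_le_sum fun i _ => ?_
    rw [← mul_pow]
    refine pow_le_pow_left₀ (norm_nonneg _) ?_ 2
    simp only [Finset.sum_apply, Pi.smul_apply]
    rw [Finset.sum_mul]
    refine (norm_sum_le _ _).trans (Finset.sum_le_sum fun r _ => ?_)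
    rw [Finset.sum_mul]
    refine (norm_sum_le _ _).trans (Finset.sum_le_sum fun s _ => ?_)
    rw [norm_smul, Real.norm_eq_abs, mul_comm]
    exact mul_le_mul_of_nonneg_left (hx r s) (norm_nonneg _)
  have h2 := Finset.single_le_sum (fun t _ => hQ t) (Finset.mem_univ t)
  have h3 := sq_nonneg A
  nlinarith

/-- A zero-forcing functional reads off one stream from the received vector. -/
theorem output_mulVec (p : Precoders M L) (H : Channel M N) {r t : Fin 2} {s : L.Stream r t}
    {φ : (Fin (N r) → ℂ) →ₗ[ℝ] ℝ} (h1 : φ (Matrix.of (H r t) *ᵥ p.vec r t s) = 1)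
    (h2 : ∀ s', s' ≠ s → φ (Matrix.of (H r t) *ᵥ p.vec r t s') = 0)
    (h3 : ∀ t', t' ≠ t → ∀ s', φ (Matrix.of (H r t') *ᵥ p.vec r t' s') = 0)
    (h4 : ∀ t' s', φ (Matrix.of (H r t') *ᵥ p.vec r.rev t' s') = 0)
    (x : (r t : Fin 2) → L.Stream r t → ℝ) (z : Fin (N r) → ℂ) :
    φ (∑ t', Matrix.of (H r t') *ᵥ (∑ r', ∑ s', x r' t' s' • p.vec r' t' s') + z) =
      x r t s + φ z := by
  have hrev : ∀ r r' : Fin 2, r' ≠ r → r' = r.rev := by decide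
  classical
  rw [map_add, map_sum, Finset.sum_eq_single t]
  · congr 1
    simp only [Matrix.mulVec_sum, map_sum, Matrix.mulVec_smul, map_smul]
    rw [Finset.sum_eq_single r, Finset.sum_eq_single s, h1, smul_eq_mul, mul_one]
    · intro s' _ hs'
      rw [h2 s' hs', smul_zero]
    · simp
    · intro r' _ hr'
      obtain rfl := hrev r r' hr'
      exact Finset.sum_eq_zero fun s' _ => by rw [h4, smul_zero]
    · simp
  · intro t' _ ht'
    simp only [Matrix.mulVec_sum, map_sum, Matrix.mulVec_smul, map_smul]
    refine Finset.sum_eq_zero fun r' _ => Finset.sum_eq_zero fun s' _ => ?_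
    by_cases hr' : r' = r
    · subst hr'
      rw [h3 t' ht', smul_zero]
    · obtain rfl := hrev r r' hr'
      rw [h4, smul_zero]
  · simp

open Classical in
/-- A pulse-amplitude code on every stream with bounded-distance decoding after zero forcing: a
decoding error requires more than `e` channel uses with a wrong hard decision on some stream. -/
theorem exists_streamCode (p : Precoders M L) (H : Channel M N)
    (φ : (r t : Fin 2) → L.Stream r t → (Fin (N r) → ℂ) →ₗ[ℝ] ℝ)
    (h1 : ∀ r t s, φ r t s (Matrix.of (H r t) *ᵥ p.vec r t s) = 1)
    (h2 : ∀ r t s s', s' ≠ s → φ r t s (Matrix.of (H r t) *ᵥ p.vec r t s') = 0)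
    (h3 : ∀ r t s t', t' ≠ t → ∀ s', φ r t s (Matrix.of (H r t') *ᵥ p.vec r t' s') = 0)
    (h4 : ∀ r t s t' s', φ r t s (Matrix.of (H r t') *ᵥ p.vec r.rev t' s') = 0)
    {Δ : ℝ} (hΔ : 0 < Δ) {n q e K : ℕ} (hK : 0 < K) (C : Fin K → Fin n → Fin q)
    (hC : ∀ i j, i ≠ j → 2 * e < hammingDist (C i) (C j)) :
    ∃ c : XCode M N (fun r t => L.Stream r t → Fin K) n,
      (∀ t w τ, c.enc t w τ = ∑ r, ∑ s, (Δ * (C (w r s) τ : ℕ) : ℝ) • p.vec r t s) ∧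
      ∀ w, (noiseLaw N n).real {z | ∃ r, c.dec r (c.output H w z r) ≠ w r} ≤
        ∑ r, ∑ t, ∑ s, (noiseLaw N n).real
          {z | e < (Finset.univ.filter fun τ => z r τ ∈ {y | Δ / 2 ≤ |φ r t s y|}).card} := by
  obtain ⟨δ, hδ⟩ := exists_decoder hK C hC
  -- rounding to the nearest multiple of `Δ`
  let quant : (r : Fin 2) → (Fin n → Fin (N r) → ℂ) → (t : Fin 2) → L.Stream r t → Fin n → ℤ :=
    fun r y t s τ => ⌊φ r t s (y τ) / Δ + 1 / 2⌋
  have hφm : ∀ r t s, Measurable (φ r t s) := fun r t s =>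
    (φ r t s).continuous_of_finiteDimensional.measurable
  have hquant : ∀ r, Measurable (quant r) := fun r =>
    measurable_pi_lambda _ fun t => measurable_pi_lambda _ fun s => measurable_pi_lambda _ fun τ =>
      Int.measurable_floor.comp
        ((((hφm r t s).comp (measurable_pi_apply τ)).div_const Δ).add_const _)
  let c : XCode M N (fun r t => L.Stream r t → Fin K) n :=
    { enc := fun t w τ => ∑ r, ∑ s, (Δ * (C (w r s) τ : ℕ) : ℝ) • p.vec r t s
      dec := fun r y t s => δ (quant r y t s)
      measurable_dec := fun r w => by
        have : MeasurableSet {a : (t : Fin 2) → L.Stream r t → Fin n → ℤ |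
            (fun t s => δ (a t s)) = w} := (Set.to_countable _).measurableSet
        exact hquant r this }
  refine ⟨c, fun t w τ => rfl, fun w => ?_⟩
  have hsub : {z | ∃ r, c.dec r (c.output H w z r) ≠ w r} ⊆ ⋃ r, ⋃ t, ⋃ s,
      {z | e < (Finset.univ.filter fun τ => z r τ ∈ {y | Δ / 2 ≤ |φ r t s y|}).card} := by
    rintro z ⟨r, hr⟩
    simp only [Set.mem_iUnion]
    by_contra hcon
    push Not at hcon
    refine hr (funext fun t => funext fun s => hδ _ _ ?_)
    have hts := hcon r t s
    simp only [Set.mem_ofPred_eq, not_lt] at hts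
    refine (Finset.card_le_card fun τ hτ => ?_).trans hts
    simp only [Finset.mem_filter, Finset.mem_univ, true_and] at hτ ⊢
    by_contra hlt
    rw [not_le] at hlt
    apply hτ
    have hout : φ r t s (c.output H w z r τ) = Δ * (C (w r t s) τ : ℕ) + φ r t s (z r τ) :=
      output_mulVec p H (h1 r t s) (h2 r t s) (h3 r t s) (h4 r t s)
        (fun r t s => Δ * (C (w r t s) τ : ℕ)) (z r τ)
    change ⌊φ r t s (c.output H w z r τ) / Δ + 1 / 2⌋ = _
    rw [hout, Int.floor_eq_iff]
    rw [abs_lt] at hlt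
    have hd : (Δ * (C (w r t s) τ : ℕ) + φ r t s (z r τ)) / Δ =
        (C (w r t s) τ : ℕ) + φ r t s (z r τ) / Δ := by
      field_simp
    rw [hd]
    have ha : -(1 / 2) < φ r t s (z r τ) / Δ := by
      rw [lt_div_iff₀ hΔ]; linarith
    have hb : φ r t s (z r τ) / Δ < 1 / 2 := by
      rw [div_lt_iff₀ hΔ]; linarith
    push_cast
    constructor <;> linarith
  refine (measureReal_mono hsub).trans ?_
  refine (measureReal_iUnion_fintype_le _).trans (Finset.sum_le_sum fun r _ => ?_)
  refine (measureReal_iUnion_fintype_le _).trans (Finset.sum_le_sum fun t _ => ?_)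
  exact measureReal_iUnion_fintype_le _

end Coding

/-! ### The rate of a stream -/

section Rates

variable {M N : Fin 2 → ℕ} {L : BlockLengths}

/-- Diagonal choice of a rate function from rates that fall short by an arbitrarily small amount. -/
theorem exists_tendsto_of_forall_sub {A : ℝ → ℝ → Prop} {d : ℝ} (hd : 0 < d)
    (h : ∀ ε, 0 < ε → ε ≤ d → ∀ᶠ P in atTop, A P (d - ε)) :
    ∃ ρ : ℝ → ℝ, (∀ᶠ P in atTop, A P (ρ P)) ∧ Tendsto ρ atTop (𝓝 d) := by
  classical
  let S : ℝ → Set ℝ := fun P => {x | x ≤ d ∧ A P x}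
  have hbdd : ∀ P, BddAbove (S P) := fun P => ⟨d, fun x hx => hx.1⟩
  let ρ : ℝ → ℝ := fun P => if hP : ∃ x ∈ S P, sSup (S P) - 1 / P < x then hP.choose else d
  have hρ : ∀ P, 0 < P → (S P).Nonempty → ρ P ∈ S P ∧ sSup (S P) - 1 / P < ρ P := by
    intro P hP hne
    have hex : ∃ x ∈ S P, sSup (S P) - 1 / P < x :=
      exists_lt_of_lt_csSup hne (sub_lt_self _ (by positivity))
    simp only [ρ, dif_pos hex]
    exact hex.choose_spec
  have hne : ∀ᶠ P in atTop, (S P).Nonempty := by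
    filter_upwards [h d hd le_rfl] with P hP
    exact ⟨d - d, by linarith, hP⟩
  refine ⟨ρ, ?_, ?_⟩
  · filter_upwards [hne, eventually_gt_atTop 0] with P h1 h2
    exact (hρ P h2 h1).1.2
  · rw [tendsto_order]
    constructor
    · intro a ha
      set ε := min ((d - a) / 2) d with hε
      have hε0 : 0 < ε := lt_min (by linarith) hd
      have hinv : Tendsto (fun P : ℝ => 1 / P) atTop (𝓝 0) := by
        simpa using tendsto_inv_atTop_zero
      filter_upwards [h ε hε0 (min_le_right _ _), eventually_gt_atTop 0,
        hinv.eventually (gt_mem_nhds (show 0 < (d - a) / 2 by linarith))] with P h1 h2 h3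
      have hmem : d - ε ∈ S P := ⟨by linarith, h1⟩
      have h4 := le_csSup (hbdd P) hmem
      have h5 := (hρ P h2 ⟨_, hmem⟩).2
      have h6 : ε ≤ (d - a) / 2 := min_le_left _ _
      linarith
    · intro a ha
      filter_upwards [hne, eventually_gt_atTop 0] with P h1 h2
      exact (hρ P h2 h1).1.1.trans_lt ha

/-- The rate of a Gilbert–Varshamov code over `q` letters that corrects `e ≤ δ n` errors. -/
theorem two_rpow_le_of_pow_le {n q e K : ℕ} {δ R : ℝ} (hq : 0 < q) (he : (e : ℝ) ≤ δ * n)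
    (hR : R ≤ (1 - 2 * δ) * Real.logb 2 q - 1) (hK : q ^ n ≤ K * (2 ^ n * q ^ (2 * e))) :
    (2 : ℝ) ^ (n * R) ≤ K := by
  have hq0 : (0 : ℝ) < q := by exact_mod_cast hq
  have hq1 : (1 : ℝ) ≤ q := by exact_mod_cast hq
  have hlog : 0 ≤ Real.logb 2 q := Real.logb_nonneg (by norm_num) hq1
  have hn : (0 : ℝ) ≤ n := Nat.cast_nonneg n
  have hpow : ∀ m : ℕ, (q : ℝ) ^ m = 2 ^ (m * Real.logb 2 q) := by
    intro m
    rw [mul_comm, Real.rpow_mul (by norm_num), Real.rpow_logb (by norm_num) (by norm_num) hq0,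
      Real.rpow_natCast]
  have hK' : (q : ℝ) ^ n ≤ K * (2 ^ n * q ^ (2 * e)) := by exact_mod_cast hK
  have h2 : (2 : ℝ) ^ n = 2 ^ (n : ℝ) := (Real.rpow_natCast 2 n).symm
  rw [hpow, hpow, h2, ← Real.rpow_add (by norm_num)] at hK'
  have h3 : (2 : ℝ) ^ (n * Real.logb 2 q) * 2 ^ (-((n : ℝ) + ((2 * e : ℕ) : ℝ) * Real.logb 2 q)) ≤
      K := by
    rw [Real.rpow_neg (by norm_num), ← div_eq_mul_inv]
    exact div_le_of_le_mul₀ (by positivity) (by positivity) hK'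
  refine le_trans ?_ h3
  rw [← Real.rpow_add (by norm_num)]
  refine Real.rpow_le_rpow_of_exponent_le (by norm_num) ?_
  push_cast
  have h4 : (e : ℝ) * Real.logb 2 q ≤ δ * n * Real.logb 2 q :=
    mul_le_mul_of_nonneg_right he hlog
  have h5 := mul_le_mul_of_nonneg_left hR hn
  nlinarith

/-- At power `P` there is room for `q ≈ √P` equally spaced amplitudes; constants are absorbed by
`ε * logb 2 P`. -/
theorem eventually_exists_amplitude {Q Δ ε : ℝ} (hQ : 0 < Q) (hΔ : 0 < Δ) (hε : 0 < ε)
    (hε1 : ε ≤ 1) :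
    ∀ᶠ P : ℝ in atTop, ∃ q : ℕ, 0 < q ∧ Q * (Δ * q) ^ 2 ≤ P ∧
      (1 / 2 - ε) * Real.logb 2 P ≤ (1 - ε) * Real.logb 2 q - 1 := by
  set C : ℝ := Real.logb 2 (√Q * (2 * Δ)) with hC
  have hlog : Tendsto (fun P : ℝ => Real.logb 2 P) atTop atTop :=
    Real.tendsto_logb_atTop (by norm_num)
  filter_upwards [eventually_ge_atTop (Q * Δ ^ 2), eventually_gt_atTop 0,
    hlog.eventually_ge_atTop (2 / ε * ((1 - ε) * C + 1))] with P h1 h0 h2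
  set x : ℝ := √(P / Q) / Δ with hx
  have hPQ : 0 < P / Q := by positivity
  have hx1 : 1 ≤ x := by
    rw [hx, one_le_div hΔ]
    refine Real.le_sqrt_of_sq_le ?_
    rw [le_div_iff₀ hQ]
    linarith
  have hq : 0 < ⌊x⌋₊ := Nat.floor_pos.2 hx1
  have hq1 : (1 : ℝ) ≤ ⌊x⌋₊ := by exact_mod_cast hq
  have hxq : x / 2 ≤ ⌊x⌋₊ := by
    have := Nat.lt_floor_add_one x
    linarith
  refine ⟨⌊x⌋₊, hq, ?_, ?_⟩
  · have h3 : (⌊x⌋₊ : ℝ) ≤ x := Nat.floor_le (by positivity)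
    have h4 : Δ * ⌊x⌋₊ ≤ √(P / Q) := by
      have := mul_le_mul_of_nonneg_left h3 hΔ.le
      rwa [hx, mul_div_cancel₀ _ hΔ.ne'] at this
    have h5 := pow_le_pow_left₀ (by positivity) h4 2
    rw [Real.sq_sqrt hPQ.le, le_div_iff₀ hQ] at h5
    linarith
  · have h6 : Real.logb 2 (x / 2) ≤ Real.logb 2 ⌊x⌋₊ :=
      Real.logb_le_logb_of_le (by norm_num) (by positivity) hxq
    have h7 : Real.logb 2 (x / 2) = Real.logb 2 P / 2 - C := by
      have hsP : 0 < √P := Real.sqrt_pos.2 h0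
      have hsQ : 0 < √Q := Real.sqrt_pos.2 hQ
      have e1 : x / 2 = √P / (√Q * (2 * Δ)) := by
        rw [hx, Real.sqrt_div h0.le]
        field_simp
      have e2 : Real.logb 2 (√P) = Real.logb 2 P / 2 := by
        simp only [Real.logb, Real.log_sqrt h0.le]
        ring
      rw [e1, Real.logb_div hsP.ne' (by positivity), e2]
    have h8 : (1 - ε) * C + 1 ≤ ε / 2 * Real.logb 2 P := by
      have := mul_le_mul_of_nonneg_left h2 (show 0 ≤ ε / 2 by positivity)
      have e : ε / 2 * (2 / ε * ((1 - ε) * C + 1)) = (1 - ε) * C + 1 := by field_simp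
      linarith
    have h9 : (1 - ε) * (Real.logb 2 P / 2 - C) ≤ (1 - ε) * Real.logb 2 ⌊x⌋₊ :=
      mul_le_mul_of_nonneg_left (by linarith) (by linarith)
    linarith

/-- At large power, a code correcting a fraction `ε / 2` of wrong hard decisions gives every stream
the rate `(1 / 2 - ε) * logb 2 P`. -/
theorem Precoders.IsAlignmentCancelation.eventually_rateAchievable {p : Precoders M L}
    {H : Channel M N} (hp : p.IsAlignmentCancelation H) {ε : ℝ} (hε : 0 < ε) (hε' : ε ≤ 1 / 2) :
    ∀ᶠ P in atTop, p.RateAchievable H P fun _ _ _ => (1 / 2 - ε) * Real.logb 2 P := by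
  choose φ h1 h2 h3 h4 using fun r t s => hp.exists_zeroForcing r t s
  -- A fraction `δ` of wrong hard decisions is corrected.  If each is wrong with probability at most
  -- `p₀`, where `p₀ ^ δ = 1 / 4`, the union bound gives an error of order `2 ^ n * (1 / 4) ^ n`.
  set δ : ℝ := ε / 2 with hδ
  have hδ0 : 0 < δ := by positivity
  set p₀ : ℝ := (1 / 4 : ℝ) ^ (1 / δ) with hp₀
  have hp₀0 : 0 < p₀ := by positivity
  have hp₀1 : p₀ ≤ 1 := Real.rpow_le_one (by norm_num) (by norm_num) (by positivity)
  have hp₀δ : p₀ ^ δ = 1 / 4 := by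
    rw [hp₀, ← Real.rpow_mul (by norm_num), one_div_mul_cancel hδ0.ne', Real.rpow_one]
  obtain ⟨m, hm, hm0⟩ : ∃ m : ℕ, (∀ r t s, (Measure.pi fun _ : Fin (N r) =>
      complexGaussian 1).real {y | (m : ℝ) ≤ |φ r t s y|} ≤ p₀) ∧ 0 < m := by
    refine Eventually.exists (f := atTop) ((eventually_all.2 fun r => eventually_all.2 fun t =>
      eventually_all.2 fun s => ?_).and (eventually_gt_atTop 0))
    exact (tendsto_measureReal_abs_ge _ (φ r t s)
      (φ r t s).continuous_of_finiteDimensional.measurable).eventually (ge_mem_nhds hp₀0)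
  obtain ⟨Q, hQ0, hQ⟩ := exists_power_constant p
  have hΔ : (0 : ℝ) < 2 * m := by positivity
  filter_upwards [eventually_exists_amplitude hQ0 hΔ hε (by linarith), eventually_ge_atTop 1]
    with P hP hP1
  obtain ⟨q, hq, hqP, hrate⟩ := hP
  refine ⟨fun r t s => mul_nonneg (by linarith) (Real.logb_nonneg (by norm_num) hP1),
    fun η hη => ?_⟩
  set S : ℝ := ∑ r : Fin 2, ∑ t : Fin 2, ∑ _ : L.Stream r t, 1 with hS
  have hlim : Tendsto (fun n : ℕ => S * (1 / 2 : ℝ) ^ n) atTop (𝓝 0) := by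
    simpa using (tendsto_pow_atTop_nhds_zero_of_lt_one (r := (1 / 2 : ℝ)) (by norm_num)
      (by norm_num)).const_mul S
  filter_upwards [hlim.eventually (ge_mem_nhds hη)] with n hn
  set e : ℕ := ⌊δ * n⌋₊ with he
  have he1 : (e : ℝ) ≤ δ * n := Nat.floor_le (by positivity)
  have he2 : δ * n ≤ (e + 1 : ℕ) := by
    push_cast
    exact (Nat.lt_floor_add_one _).le
  obtain ⟨K, C, hC, hKq⟩ := exists_code_hammingDist n q (2 * e) hq
  have hK : 0 < K := by
    rcases Nat.eq_zero_or_pos K with h | h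
    · rw [h, zero_mul] at hKq
      exact absurd hKq (not_le.2 (pow_pos hq n))
    · exact h
  obtain ⟨c, henc, herr⟩ := exists_streamCode p H φ h1 h2 h3 h4 hΔ hK C hC
  refine ⟨fun _ _ _ => K, fun r t s => two_rpow_le_of_pow_le hq he1 ?_ hKq, c,
    ⟨fun r t s i τ => 2 * m * (C i τ : ℕ), henc⟩, ?_, ?_⟩
  · have : 1 - 2 * δ = 1 - ε := by rw [hδ]; ring
    rw [this]
    exact hrate
  · intro t w
    have hτ : ∀ τ ∈ (Finset.univ : Finset (Fin n)), ∑ i, ‖c.enc t w τ i‖ ^ 2 ≤ P := by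
      intro τ _
      rw [henc]
      refine (hQ t (fun r s => 2 * m * (C (w r s) τ : ℕ)) (2 * m * q) fun r s => ?_).trans hqP
      rw [abs_of_nonneg (by positivity)]
      refine mul_le_mul_of_nonneg_left ?_ hΔ.le
      exact_mod_cast (C (w r s) τ).2.le
    refine (Finset.sum_le_card_nsmul _ _ _ hτ).trans ?_
    simp
  · have hbound : ∀ w : (r t : Fin 2) → L.Stream r t → Fin K,
        (noiseLaw N n).real {z | ∃ r, c.dec r (c.output H w z r) ≠ w r} ≤ η := by
      intro w
      refine (herr w).trans (le_trans ?_ hn)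
      rw [hS, Finset.sum_mul]
      refine Finset.sum_le_sum fun r _ => ?_
      rw [Finset.sum_mul]
      refine Finset.sum_le_sum fun t _ => ?_
      rw [Finset.sum_mul]
      refine Finset.sum_le_sum fun s _ => ?_
      refine (noiseLaw_lt_card_le N n r _ e).trans ?_
      have hset : {y : Fin (N r) → ℂ | 2 * (m : ℝ) / 2 ≤ |φ r t s y|} =
          {y | (m : ℝ) ≤ |φ r t s y|} := by
        simp
      rw [hset]
      have hpow : (Measure.pi fun _ : Fin (N r) => complexGaussian 1).real
          {y | (m : ℝ) ≤ |φ r t s y|} ^ (e + 1) ≤ (1 / 4) ^ n := by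
        refine (pow_le_pow_left₀ measureReal_nonneg (hm r t s) _).trans ?_
        rw [← Real.rpow_natCast p₀ (e + 1)]
        refine (Real.rpow_le_rpow_of_exponent_ge hp₀0 hp₀1 he2).trans ?_
        rw [Real.rpow_mul hp₀0.le, hp₀δ, Real.rpow_natCast]
      refine (mul_le_mul_of_nonneg_left hpow (by positivity)).trans ?_
      rw [← mul_pow, one_mul]
      norm_num
    unfold XCode.errorProb
    refine div_le_of_le_mul₀ (by positivity) hη.le ?_
    refine (Finset.sum_le_card_nsmul _ _ _ fun w _ => hbound w).trans ?_
    rw [nsmul_eq_mul, mul_comm, Finset.card_univ]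

/-- Every alignment and cancelation scheme gives each real stream half a degree of freedom. -/
theorem Precoders.IsAlignmentCancelation.doFAchievable {p : Precoders M L} {H : Channel M N}
    (hp : p.IsAlignmentCancelation H) : p.DoFAchievable H fun _ _ _ => 1 / 2 := by
  obtain ⟨ρ, h1, h2⟩ := exists_tendsto_of_forall_sub
    (A := fun P x => p.RateAchievable H P fun _ _ _ => x * Real.logb 2 P) (d := 1 / 2)
    (by norm_num) fun ε hε hε' => hp.eventually_rateAchievable hε hε'
  refine ⟨fun P _ _ _ => ρ P * Real.logb 2 P, h1, fun r t s => h2.congr' ?_⟩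
  filter_upwards [eventually_gt_atTop 1] with P hP
  rw [mul_div_cancel_right₀ _ (Real.logb_pos (by norm_num) hP).ne']

end Rates

/-! ### From streams to messages -/

section Messages

variable {M N : Fin 2 → ℕ} {L : BlockLengths}

/-- Renaming the messages changes neither power nor error probability. -/
theorem XCode.exists_relabel {W W' : Fin 2 → Fin 2 → Type} {n : ℕ} [∀ r t, Fintype (W r t)]
    [∀ r t, Fintype (W' r t)] (e : ∀ r t, W' r t ≃ W r t) (c : XCode M N W n) (H : Channel M N)
    {P : ℝ} (hP : c.PowerLE P) :
    ∃ c' : XCode M N W' n, c'.PowerLE P ∧ c'.errorProb H = c.errorProb H := by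
  let c' : XCode M N W' n :=
    { enc := fun t w => c.enc t fun r => e r t (w r)
      dec := fun r y t => (e r t).symm (c.dec r y t)
      measurable_dec := fun r w => by
        convert c.measurable_dec r (fun t => e r t (w t)) using 1
        ext y
        simp only [Set.mem_preimage, Set.mem_singleton_iff, funext_iff, Equiv.symm_apply_eq] }
  refine ⟨c', fun t w => hP t _, ?_⟩
  let E : ((r t : Fin 2) → W' r t) ≃ ((r t : Fin 2) → W r t) :=
    Equiv.piCongrRight fun r => Equiv.piCongrRight fun t => e r t
  unfold XCode.errorProb
  rw [Fintype.card_congr E, ← Equiv.sum_comp E]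
  congr 1
  refine Finset.sum_congr rfl fun w _ => ?_
  congr 1
  ext z
  refine exists_congr fun r => not_congr ?_
  have hout : c'.output H w z r = c.output H (E w) z r := rfl
  rw [hout, funext_iff, funext_iff]
  exact forall_congr' fun t => Equiv.symm_apply_eq _

theorem Precoders.RateAchievable.sum {p : Precoders M L} {H : Channel M N} {P : ℝ}
    {R : (r t : Fin 2) → L.Stream r t → ℝ} (h : p.RateAchievable H P R) :
    MIMOX.RateAchievable H P fun r t => ∑ s, R r t s := by
  refine ⟨fun r t => Finset.sum_nonneg fun s _ => h.1 r t s, fun ε hε => ?_⟩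
  filter_upwards [h.2 ε hε] with n hn
  obtain ⟨K, hK, c, -, hP, he⟩ := hn
  obtain ⟨c', hP', he'⟩ := c.exists_relabel (W' := fun r t => Fin (∏ s, K r t s))
    (fun r t => (Fintype.equivFinOfCardEq (by simp)).symm) H hP
  refine ⟨fun r t => ∏ s, K r t s, fun r t => ?_, c', hP', he'.trans_le he⟩
  rw [Finset.mul_sum, Real.rpow_sum_of_pos (by norm_num)]
  push_cast
  exact Finset.prod_le_prod (fun s _ => by positivity) fun s _ => hK r t s

theorem Precoders.DoFAchievable.sum {p : Precoders M L} {H : Channel M N}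
    {d : (r t : Fin 2) → L.Stream r t → ℝ} (h : p.DoFAchievable H d) :
    MIMOX.DoFAchievable H fun r t => ∑ s, d r t s := by
  obtain ⟨R, h1, h2⟩ := h
  refine ⟨fun P r t => ∑ s, R P r t s, h1.mono fun P hP => hP.sum, fun r t => ?_⟩
  simp only [Finset.sum_div]
  exact tendsto_finsetSum _ fun s _ => h2 r t s

end Messages

/-! ### Shifted and tilted Gaussian laws -/

section Tilt

open scoped ENNReal

/-- A Gaussian law shifted by `m` and reweighted by `exp (|z - m|² / 2)` is dominated by a centred
Gaussian law of larger variance. -/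
theorem complexGaussian_tilt_le (m : ℂ) {s : ℝ≥0} (hs : 2 < s) :
    ((complexGaussian 1).map (m + ·)).withDensity
        (fun x => ENNReal.ofReal (Real.exp (‖x - m‖ ^ 2 / 2))) ≤
      Real.toNNReal (s * Real.exp (‖m‖ ^ 2 / (s - 2))) • complexGaussian s := by
  have hs' : (2 : ℝ) < s := by exact_mod_cast hs
  have hs0 : s ≠ 0 := (lt_trans two_pos hs).ne'
  refine Measure.le_iff.2 fun A hA => ?_
  have hmh : Measurable fun x : ℂ => ENNReal.ofReal (Real.exp (‖x - m‖ ^ 2 / 2)) := by fun_prop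
  have hmf : ∀ v : ℝ≥0, Measurable fun z : ℂ =>
      ENNReal.ofReal ((Real.pi * v)⁻¹ * Real.exp (-‖z‖ ^ 2 / v)) := fun v => by fun_prop
  rw [withDensity_apply _ hA, ← lintegral_indicator hA,
    lintegral_map (hmh.indicator hA) (measurable_const_add m),
    complexGaussian_eq_withDensity one_ne_zero, complexGaussian_eq_withDensity hs0,
    lintegral_withDensity_eq_lintegral_mul _ (hmf 1) (show Measurable fun a => A.indicator
      (fun x => ENNReal.ofReal (Real.exp (‖x - m‖ ^ 2 / 2))) (m + a) from
        (hmh.indicator hA).comp (measurable_const_add m)),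
    Measure.smul_apply, withDensity_apply _ hA, ← lintegral_indicator hA,
    ENNReal.smul_def, smul_eq_mul, ← lintegral_const_mul _ ((hmf s).indicator hA)]
  refine le_trans ?_ (lintegral_add_left_eq_self _ m).le
  refine lintegral_mono fun z => ?_
  simp only [Pi.mul_apply]
  by_cases hz : m + z ∈ A
  · rw [Set.indicator_of_mem hz, Set.indicator_of_mem hz, ← ENNReal.ofReal_mul (by positivity)]
    change _ ≤ ENNReal.ofReal _ * _
    rw [← ENNReal.ofReal_mul (by positivity)]
    refine ENNReal.ofReal_le_ofReal ?_
    rw [add_sub_cancel_left, mul_assoc, ← Real.exp_add]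
    have e1 : (s : ℝ) * Real.exp (‖m‖ ^ 2 / (s - 2)) *
        ((Real.pi * s)⁻¹ * Real.exp (-‖m + z‖ ^ 2 / s)) =
        Real.pi⁻¹ * Real.exp (‖m‖ ^ 2 / (s - 2) + -‖m + z‖ ^ 2 / s) := by
      rw [Real.exp_add]
      field_simp
    rw [e1]
    have e2 : (Real.pi * ((1 : ℝ≥0) : ℝ))⁻¹ = Real.pi⁻¹ := by simp
    rw [e2]
    refine mul_le_mul_of_nonneg_left (Real.exp_le_exp.2 ?_) (by positivity)
    -- `|m + z|² ≤ (s / 2) |z|² + s / (s - 2) |m|²`, by the inequality of the means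
    have h1 : ‖m + z‖ ^ 2 ≤ (‖m‖ + ‖z‖) ^ 2 := pow_le_pow_left₀ (norm_nonneg _) (norm_add_le _ _) 2
    have h2 : (‖m‖ + ‖z‖) ^ 2 ≤ s * (‖m‖ ^ 2 / (s - 2) + ‖z‖ ^ 2 / 2) := by
      have hpos : (0 : ℝ) < s - 2 := by linarith
      have h3 : s * (‖m‖ ^ 2 / (s - 2) + ‖z‖ ^ 2 / 2) - (‖m‖ + ‖z‖) ^ 2 =
          (2 * ‖m‖ - (s - 2) * ‖z‖) ^ 2 / (2 * (s - 2)) := by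
        field_simp
        ring
      have h4 : 0 ≤ (2 * ‖m‖ - (s - 2) * ‖z‖) ^ 2 / (2 * (s - 2)) := by positivity
      linarith
    have h5 : ‖m + z‖ ^ 2 / s ≤ ‖m‖ ^ 2 / (s - 2) + ‖z‖ ^ 2 / 2 := by
      rw [div_le_iff₀ (by linarith)]
      linarith
    push_cast
    rw [div_one, neg_div]
    linarith
  · simp [Set.indicator_of_notMem hz]

/-- The law of `n` channel uses with `m` antennas, all entries being i.i.d. `CN(0, s)`. -/
noncomputable def blockGaussian (n m : ℕ) (s : ℝ≥0) : Measure (Fin n → Fin m → ℂ) :=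
  Measure.pi fun _ => Measure.pi fun _ => complexGaussian s

instance (n m : ℕ) (s : ℝ≥0) : IsProbabilityMeasure (blockGaussian n m s) := by
  unfold blockGaussian; infer_instance

/-- The energy of a block. -/
noncomputable def energy {n m : ℕ} (x : Fin n → Fin m → ℂ) : ℝ := ∑ τ, ∑ i, ‖x τ i‖ ^ 2

theorem energy_nonneg {n m : ℕ} (x : Fin n → Fin m → ℂ) : 0 ≤ energy x :=
  Finset.sum_nonneg fun _ _ => Finset.sum_nonneg fun _ _ => sq_nonneg _

@[fun_prop]
theorem measurable_energy {n m : ℕ} : Measurable (energy : (Fin n → Fin m → ℂ) → ℝ) := by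
  unfold energy
  fun_prop

/-- The shift `m` of unit Gaussian noise, tilted by `exp (energy z / 2)`, costs a factor depending
on `energy m` when the law is replaced by a centred one of variance `s`.  No measurability of `F` is
needed. -/
theorem lintegral_tilt_le {n k : ℕ} (m : Fin n → Fin k → ℂ) {s : ℝ≥0} (hs : 2 < s)
    (F : (Fin n → Fin k → ℂ) → ℝ≥0∞) :
    ∫⁻ z, ENNReal.ofReal (Real.exp (energy z / 2)) * F (m + z) ∂blockGaussian n k 1 ≤
      ENNReal.ofReal ((s : ℝ) ^ (n * k) * Real.exp (energy m / (s - 2))) *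
        ∫⁻ x, F x ∂blockGaussian n k s := by
  have hprob : ∀ τ i, IsProbabilityMeasure ((complexGaussian 1).map (m τ i + ·)) := fun τ i =>
    Measure.isProbabilityMeasure_map (measurable_const_add _).aemeasurable
  have h1 : ∀ τ, (Measure.pi fun i => (complexGaussian 1).map (m τ i + ·)).withDensity
      (fun x => ∏ i, ENNReal.ofReal (Real.exp (‖x i - m τ i‖ ^ 2 / 2))) ≤
      (∏ i, Real.toNNReal (s * Real.exp (‖m τ i‖ ^ 2 / (s - 2)))) •
        Measure.pi fun _ : Fin k => complexGaussian s := fun τ =>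
    withDensity_pi_le _ _ (fun i x => ENNReal.ofReal (Real.exp (‖x - m τ i‖ ^ 2 / 2)))
      (fun i => by fun_prop) _ fun i => complexGaussian_tilt_le (m τ i) hs
  have h2 := withDensity_pi_le (fun τ => Measure.pi fun i => (complexGaussian 1).map (m τ i + ·))
    (fun _ => Measure.pi fun _ : Fin k => complexGaussian s)
    (fun τ x => ∏ i, ENNReal.ofReal (Real.exp (‖x i - m τ i‖ ^ 2 / 2)))
    (fun τ => by fun_prop) _ h1
  have h3 : (Measure.pi fun τ => Measure.pi fun i => (complexGaussian 1).map (m τ i + ·)) =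
      (blockGaussian n k 1).map (m + ·) := by
    rw [blockGaussian]
    have e1 : ∀ τ, (Measure.pi fun i => (complexGaussian 1).map (m τ i + ·)) =
        (Measure.pi fun _ : Fin k => complexGaussian 1).map (m τ + ·) := fun τ =>
      (Measure.pi_map_pi fun i => (measurable_const_add _).aemeasurable).symm
    simp only [e1]
    have : ∀ τ, IsProbabilityMeasure
        ((Measure.pi fun _ : Fin k => complexGaussian 1).map (m τ + ·)) := fun τ =>
      Measure.isProbabilityMeasure_map (measurable_const_add _).aemeasurable
    exact (Measure.pi_map_pi fun τ => (measurable_const_add _).aemeasurable).symm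
  have h4 : ∀ x : Fin n → Fin k → ℂ,
      ∏ τ, ∏ i, ENNReal.ofReal (Real.exp (‖x τ i - m τ i‖ ^ 2 / 2)) =
      ENNReal.ofReal (Real.exp (energy (x - m) / 2)) := by
    intro x
    simp only [← ENNReal.ofReal_prod_of_nonneg (fun i _ => (Real.exp_pos _).le),
      ← Real.exp_sum, energy, Finset.sum_div, Pi.sub_apply]
  have h5 : ∏ τ, ∏ i, Real.toNNReal (s * Real.exp (‖m τ i‖ ^ 2 / (s - 2))) =
      Real.toNNReal ((s : ℝ) ^ (n * k) * Real.exp (energy m / (s - 2))) := by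
    have e1 : ∀ τ, ∏ i, Real.toNNReal (s * Real.exp (‖m τ i‖ ^ 2 / (s - 2))) =
        Real.toNNReal (∏ i, (s * Real.exp (‖m τ i‖ ^ 2 / (s - 2)))) := fun τ =>
      (Real.toNNReal_prod_of_nonneg fun i _ => mul_nonneg s.2 (Real.exp_pos _).le).symm
    have e2 : ∏ τ, Real.toNNReal (∏ i, (s * Real.exp (‖m τ i‖ ^ 2 / (s - 2)))) =
        Real.toNNReal (∏ τ, ∏ i, (s * Real.exp (‖m τ i‖ ^ 2 / (s - 2)))) :=
      (Real.toNNReal_prod_of_nonneg fun i _ => Finset.prod_nonneg fun j _ =>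
        mul_nonneg s.2 (Real.exp_pos _).le).symm
    simp only [e1, e2]
    congr 1
    simp only [Finset.prod_mul_distrib, Finset.prod_const, Finset.card_univ, Fintype.card_fin,
      ← Real.exp_sum, energy, Finset.sum_div, ← pow_mul, mul_comm k n]
  rw [h3, h5] at h2
  simp only [h4] at h2
  have hm : Measurable fun x : Fin n → Fin k → ℂ =>
      ENNReal.ofReal (Real.exp (energy (x - m) / 2)) := by
    fun_prop
  calc ∫⁻ z, ENNReal.ofReal (Real.exp (energy z / 2)) * F (m + z) ∂blockGaussian n k 1
      = ∫⁻ x, ENNReal.ofReal (Real.exp (energy (x - m) / 2)) * F x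
          ∂(blockGaussian n k 1).map (m + ·) := by
        change _ = ∫⁻ x, _ ∂(blockGaussian n k 1).map (MeasurableEquiv.addLeft m)
        rw [(MeasurableEquiv.addLeft m).measurableEmbedding.lintegral_map]
        simp
    _ = ∫⁻ x, F x ∂((blockGaussian n k 1).map (m + ·)).withDensity
          (fun x => ENNReal.ofReal (Real.exp (energy (x - m) / 2))) := by
        rw [lintegral_withDensity_eq_lintegral_mul_non_measurable _ hm
          (ae_of_all _ fun x => ENNReal.ofReal_lt_top)]
        rfl
    _ ≤ ∫⁻ x, F x ∂(Real.toNNReal ((s : ℝ) ^ (n * k) * Real.exp (energy m / (s - 2))) •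
          blockGaussian n k s) := lintegral_mono' h2 le_rfl
    _ = _ := by
        rw [lintegral_smul_measure]
        rfl

end Tilt

/-! ### A packing bound for successive decoding -/

section Packing

open scoped ENNReal

/-- Superadditivity of the lower integral, without measurability. -/
theorem sum_lintegral_le {α ι : Type*} [MeasurableSpace α] (μ : Measure α) (s : Finset ι)
    (f : ι → α → ℝ≥0∞) : ∑ i ∈ s, ∫⁻ x, f i x ∂μ ≤ ∫⁻ x, ∑ i ∈ s, f i x ∂μ := by
  classical
  induction s using Finset.induction_on with
  | empty => simp
  | insert i s hi ih =>
    simp only [Finset.sum_insert hi]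
    exact (add_le_add le_rfl ih).trans (le_lintegral_add _ _)

theorem sum_measure_preimage_le_one {α β ι : Type*} [MeasurableSpace α] [MeasurableSpace β]
    [Fintype ι] (μ : Measure α) [IsProbabilityMeasure μ] {g : α → β} (hg : Measurable g)
    {D : ι → Set β} (hD : Pairwise (Function.onFun Disjoint D)) (hm : ∀ i, MeasurableSet (D i)) :
    ∑ i, μ {x | g x ∈ D i} ≤ 1 := by
  refine (sum_measure_le_measure_univ (μ := μ) (s := Finset.univ) (t := fun i => {x | g x ∈ D i})
    (fun i _ => (hg (hm i)).nullMeasurableSet) fun i _ j _ hij => ?_).trans measure_univ.le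
  exact ((hD hij).preimage g).aedisjoint

theorem sum_indicator_le_one {β ι : Type*} [Fintype ι] {D : ι → Set β}
    (hD : Pairwise (Function.onFun Disjoint D)) (x : β) (f : ι → ℝ≥0∞) (hf : ∀ i, f i ≤ 1) :
    ∑ i, (D i).indicator (fun _ => f i) x ≤ 1 := by
  classical
  by_cases h : ∃ i, x ∈ D i
  · obtain ⟨i, hi⟩ := h
    rw [Finset.sum_eq_single i]
    · rw [Set.indicator_of_mem hi]
      exact hf i
    · intro j _ hj
      exact Set.indicator_of_notMem (fun hxj => Set.disjoint_left.1 (hD hj) hxj hi) _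
    · simp
  · simp only [not_exists] at h
    simp [Set.indicator_of_notMem (h _)]

/-- Probability that unit Gaussian noise carries `m` into `D`: the shift may be changed to `m + e`
at the price of a larger variance `s` and of a factor governed by the energy of `e`. -/
theorem blockGaussian_shift_le {n k : ℕ} (m e : Fin n → Fin k → ℂ) {s : ℝ≥0} (hs : 2 < s)
    {D : Set (Fin n → Fin k → ℂ)} (hD : MeasurableSet D) :
    blockGaussian n k 1 {z | m + z ∈ D} ≤
      ENNReal.ofReal ((s : ℝ) ^ (n * k) * Real.exp (energy e / (s - 2))) *
        blockGaussian n k s {x | m + e + x ∈ D} := by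
  have hD1 : MeasurableSet {z : Fin n → Fin k → ℂ | m + z ∈ D} := (measurable_const_add m) hD
  have hD2 : MeasurableSet {z : Fin n → Fin k → ℂ | m + e + z ∈ D} :=
    (measurable_const_add (m + e)) hD
  have h := lintegral_tilt_le (-e) hs
    ({x : Fin n → Fin k → ℂ | m + e + x ∈ D}.indicator fun _ => (1 : ℝ≥0∞))
  have he : energy (-e) = energy e := by simp [energy]
  rw [he, lintegral_indicator_const hD2, one_mul] at h
  refine le_trans ?_ h
  rw [← one_mul (blockGaussian n k 1 _), ← lintegral_indicator_const hD1]
  refine lintegral_mono fun z => ?_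
  by_cases hz : m + z ∈ D
  · have hz' : m + e + (-e + z) ∈ D := by
      convert hz using 1
      abel
    rw [Set.indicator_of_mem (show z ∈ {z | m + z ∈ D} from hz),
      Set.indicator_of_mem (show -e + z ∈ {x | m + e + x ∈ D} from hz'), mul_one]
    rw [← ENNReal.ofReal_one]
    exact ENNReal.ofReal_le_ofReal (Real.one_le_exp (by have := energy_nonneg z; positivity))
  · rw [Set.indicator_of_notMem (show z ∉ {z | m + z ∈ D} from hz)]
    exact zero_le

/-- Suppose that a first receiver observes `a₀ w₀ + a w₀ w₁ + z` and decodes `w₀`, and that a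
second one observes `b₀ w₀ + S (a w₀ w₁) (l w₀ w₁) + z'` and decodes `w₁`, where `S` is additive
and of bounded gain.  An observer of `a₀ w₀ + a w₀ w₁ + z` and `l w₀ w₁ + y` can decode `w₀`, and
then `w₁`; comparing both noises with Gaussian laws of large variance `s`, which do not depend on
the messages, bounds the number of pairs `(w₀, w₁)`. -/
theorem sum_mul_le_of_successive_decoding {n n₀ k n₁ : ℕ} {W₀ W₁ : Type*} [Fintype W₀]
    [Fintype W₁] {D₀ : W₀ → Set (Fin n → Fin n₀ → ℂ)} {D₁ : W₀ → W₁ → Set (Fin n → Fin n₁ → ℂ)}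
    (hD₀ : Pairwise (Function.onFun Disjoint D₀)) (hm₀ : ∀ w, MeasurableSet (D₀ w))
    (hD₁ : ∀ w, Pairwise (Function.onFun Disjoint (D₁ w))) (hm₁ : ∀ w w', MeasurableSet (D₁ w w'))
    (a₀ : W₀ → Fin n → Fin n₀ → ℂ) (b₀ : W₀ → Fin n → Fin n₁ → ℂ)
    (a : W₀ → W₁ → Fin n → Fin n₀ → ℂ) (l : W₀ → W₁ → Fin n → Fin k → ℂ)
    (S : (Fin n → Fin n₀ → ℂ) → (Fin n → Fin k → ℂ) → Fin n → Fin n₁ → ℂ)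
    (hS : ∀ x z y y', S (x + z) (y + y') = S x y + S z y') {s s₁ : ℝ≥0} (hs : 2 < s)
    (hs₁ : 2 < s₁) (hSe : ∀ z y, energy (S z y) ≤ (s₁ - 2) / 2 * (energy z + energy y)) {E : ℝ}
    (hE : ∀ w w', energy (a₀ w + a w w') + energy (l w w') ≤ E) :
    ∑ w, ∑ w', blockGaussian n n₀ 1 {z | a₀ w + a w w' + z ∈ D₀ w} *
        blockGaussian n n₁ 1 {z | b₀ w + S (a w w') (l w w') + z ∈ D₁ w w'} ≤
      ENNReal.ofReal ((s₁ : ℝ) ^ (n * n₁) *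
        ((s : ℝ) ^ (n * (n₀ + k)) * Real.exp (E / (s - 2)))) := by
  have hs' : (0 : ℝ) < s - 2 := sub_pos.2 (by exact_mod_cast hs)
  have hs₁' : (0 : ℝ) < s₁ - 2 := sub_pos.2 (by exact_mod_cast hs₁)
  let Q : W₀ → W₁ → (Fin n → Fin n₁ → ℂ) → ℝ≥0∞ := fun w w' u =>
    blockGaussian n n₁ s₁ {x | u + x ∈ D₁ w w'}
  let G : W₀ → W₁ → (Fin n → Fin n₀ → ℂ) → (Fin n → Fin k → ℂ) → ℝ≥0∞ := fun w w' v y =>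
    (D₀ w).indicator (fun _ => Q w w' (b₀ w + S (v - a₀ w) y)) v
  set C : ℝ≥0∞ := ENNReal.ofReal ((s₁ : ℝ) ^ (n * n₁) *
        ((s : ℝ) ^ (n * (n₀ + k)) * Real.exp (E / (s - 2)))) with hC
  set c₁ : ℝ≥0∞ := ENNReal.ofReal ((s₁ : ℝ) ^ (n * n₁)) with hc₁
  have key : ∀ w w', blockGaussian n n₀ 1 {z | a₀ w + a w w' + z ∈ D₀ w} *
        blockGaussian n n₁ 1 {z | b₀ w + S (a w w') (l w w') + z ∈ D₁ w w'} ≤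
      C * ∫⁻ v, ∫⁻ y, G w w' v y ∂blockGaussian n k s ∂blockGaussian n n₀ s := by
    intro w w'
    set p₁ := blockGaussian n n₁ 1 {z | b₀ w + S (a w w') (l w w') + z ∈ D₁ w w'}
    -- the second decoding probability, with the shift perturbed by `S z y`
    have h1 : ∀ z y, p₁ ≤ c₁ * (ENNReal.ofReal (Real.exp (energy z / 2)) *
        (ENNReal.ofReal (Real.exp (energy y / 2)) *
          Q w w' (b₀ w + S (a w w' + z) (l w w' + y)))) := by
      intro z y
      refine (blockGaussian_shift_le _ (S z y) hs₁ (hm₁ w w')).trans ?_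
      rw [← mul_assoc, ← mul_assoc, hc₁, ← ENNReal.ofReal_mul (by positivity),
        ← ENNReal.ofReal_mul (by positivity), mul_assoc, ← Real.exp_add]
      have e1 : b₀ w + S (a w w') (l w w') + S z y = b₀ w + S (a w w' + z) (l w w' + y) := by
        rw [hS, add_assoc]
      rw [e1]
      refine mul_le_mul_left (ENNReal.ofReal_le_ofReal ?_) _
      refine mul_le_mul_of_nonneg_left (Real.exp_le_exp.2 ?_) (by positivity)
      rw [div_le_iff₀ hs₁']
      calc _ ≤ _ := hSe z y
        _ = _ := by ring
    have h2 : ∀ z, p₁ ≤ c₁ * (ENNReal.ofReal (Real.exp (energy z / 2)) *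
        (ENNReal.ofReal ((s : ℝ) ^ (n * k) * Real.exp (energy (l w w') / (s - 2))) *
          ∫⁻ y, Q w w' (b₀ w + S (a w w' + z) y) ∂blockGaussian n k s)) := by
      intro z
      calc p₁ = ∫⁻ _, p₁ ∂blockGaussian n k 1 := by simp
        _ ≤ ∫⁻ y, c₁ * (ENNReal.ofReal (Real.exp (energy z / 2)) *
              (ENNReal.ofReal (Real.exp (energy y / 2)) *
                Q w w' (b₀ w + S (a w w' + z) (l w w' + y)))) ∂blockGaussian n k 1 :=
            lintegral_mono fun y => h1 z y
        _ = c₁ * (ENNReal.ofReal (Real.exp (energy z / 2)) *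
              ∫⁻ y, (ENNReal.ofReal (Real.exp (energy y / 2)) *
                Q w w' (b₀ w + S (a w w' + z) (l w w' + y))) ∂blockGaussian n k 1) := by
            rw [lintegral_const_mul' _ _ ENNReal.ofReal_ne_top,
              lintegral_const_mul' _ _ ENNReal.ofReal_ne_top]
        _ ≤ _ := by
            gcongr
            exact lintegral_tilt_le (l w w') hs fun y => Q w w' (b₀ w + S (a w w' + z) y)
    set c₂ : ℝ≥0∞ := ENNReal.ofReal ((s : ℝ) ^ (n * k) * Real.exp (energy (l w w') / (s - 2)))
      with hc₂
    have hD : MeasurableSet {z | a₀ w + a w w' + z ∈ D₀ w} :=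
      (measurable_const_add (a₀ w + a w w')) (hm₀ w)
    calc blockGaussian n n₀ 1 {z | a₀ w + a w w' + z ∈ D₀ w} * p₁
        = ∫⁻ z, {z | a₀ w + a w w' + z ∈ D₀ w}.indicator (fun _ => p₁) z
            ∂blockGaussian n n₀ 1 := by
          rw [lintegral_indicator_const hD, mul_comm]
      _ ≤ ∫⁻ z, c₁ * (c₂ * (ENNReal.ofReal (Real.exp (energy z / 2)) *
            ∫⁻ y, G w w' (a₀ w + a w w' + z) y ∂blockGaussian n k s)) ∂blockGaussian n n₀ 1 := by
          refine lintegral_mono fun z => ?_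
          by_cases hz : a₀ w + a w w' + z ∈ D₀ w
          · rw [Set.indicator_of_mem (show z ∈ {z | a₀ w + a w w' + z ∈ D₀ w} from hz)]
            refine (h2 z).trans (le_of_eq ?_)
            have e2 : ∀ y, G w w' (a₀ w + a w w' + z) y =
                Q w w' (b₀ w + S (a w w' + z) y) := by
              intro y
              have e3 : a₀ w + a w w' + z - a₀ w = a w w' + z := by abel
              simp only [G, Set.indicator_of_mem hz, e3]
            simp only [e2]
            ring
          · rw [Set.indicator_of_notMem (show z ∉ {z | a₀ w + a w w' + z ∈ D₀ w} from hz)]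
            exact zero_le
      _ = c₁ * (c₂ * ∫⁻ z, ENNReal.ofReal (Real.exp (energy z / 2)) *
            ∫⁻ y, G w w' (a₀ w + a w w' + z) y ∂blockGaussian n k s ∂blockGaussian n n₀ 1) := by
          rw [lintegral_const_mul' _ _ ENNReal.ofReal_ne_top,
            lintegral_const_mul' _ _ ENNReal.ofReal_ne_top]
      _ ≤ c₁ * (c₂ * (ENNReal.ofReal ((s : ℝ) ^ (n * n₀) *
            Real.exp (energy (a₀ w + a w w') / (s - 2))) *
            ∫⁻ v, ∫⁻ y, G w w' v y ∂blockGaussian n k s ∂blockGaussian n n₀ s)) := by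
          gcongr
          exact lintegral_tilt_le (a₀ w + a w w') hs
            fun v => ∫⁻ y, G w w' v y ∂blockGaussian n k s
      _ ≤ _ := by
          rw [← mul_assoc, ← mul_assoc, hc₁, hc₂, ← ENNReal.ofReal_mul (by positivity),
            ← ENNReal.ofReal_mul (by positivity), hC]
          refine mul_le_mul_left (ENNReal.ofReal_le_ofReal ?_) _
          have e4 : (s₁ : ℝ) ^ (n * n₁) * (s ^ (n * k) * Real.exp (energy (l w w') / (s - 2))) *
              (s ^ (n * n₀) * Real.exp (energy (a₀ w + a w w') / (s - 2))) =
              s₁ ^ (n * n₁) * (s ^ (n * (n₀ + k)) * Real.exp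
                ((energy (a₀ w + a w w') + energy (l w w')) / (s - 2))) := by
            rw [add_div, Real.exp_add, mul_add n, pow_add]
            ring
          rw [e4]
          gcongr
          exact hE w w'
  have hQ : ∀ w u, ∑ w', Q w w' u ≤ 1 := fun w u =>
    sum_measure_preimage_le_one _ (measurable_const_add u) (hD₁ w) (hm₁ w)
  have hG : ∀ v y, ∑ w, ∑ w', G w w' v y ≤ 1 := by
    intro v y
    have e5 : ∀ w, ∑ w', G w w' v y =
        (D₀ w).indicator (fun _ => ∑ w', Q w w' (b₀ w + S (v - a₀ w) y)) v := by
      intro w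
      by_cases hv : v ∈ D₀ w
      · simp only [G, Set.indicator_of_mem hv]
      · simp only [G, Set.indicator_of_notMem hv, Finset.sum_const_zero]
    simp only [e5]
    exact sum_indicator_le_one hD₀ v _ fun w => hQ w _
  calc _ ≤ ∑ w, ∑ w', C * ∫⁻ v, ∫⁻ y, G w w' v y ∂blockGaussian n k s ∂blockGaussian n n₀ s :=
        Finset.sum_le_sum fun w _ => Finset.sum_le_sum fun w' _ => key w w'
    _ = C * ∑ w, ∑ w', ∫⁻ v, ∫⁻ y, G w w' v y ∂blockGaussian n k s ∂blockGaussian n n₀ s := by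
        simp only [Finset.mul_sum]
    _ ≤ C * ∫⁻ v, ∫⁻ y, ∑ w, ∑ w', G w w' v y ∂blockGaussian n k s ∂blockGaussian n n₀ s := by
        gcongr
        refine (Finset.sum_le_sum fun w _ => (sum_lintegral_le _ _ _).trans
          (lintegral_mono fun v => sum_lintegral_le _ _ _)).trans ?_
        exact (sum_lintegral_le _ _ _).trans (lintegral_mono fun v => sum_lintegral_le _ _ _)
    _ ≤ C * ∫⁻ _, ∫⁻ _, 1 ∂blockGaussian n k s ∂blockGaussian n n₀ s := by
        gcongr with v y
        exact hG v y
    _ = C := by simp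

end Packing

/-! ### Outer bounds -/

section LinearGain

theorem energy_add_le {n m : ℕ} (x y : Fin n → Fin m → ℂ) :
    energy (x + y) ≤ 2 * (energy x + energy y) := by
  simp only [energy, ← Finset.sum_add_distrib, Finset.mul_sum]
  refine Finset.sum_le_sum fun τ _ => Finset.sum_le_sum fun i _ => ?_
  have h := pow_le_pow_left₀ (norm_nonneg _) (norm_add_le (x τ i) (y τ i)) 2
  have h' := sq_nonneg (‖x τ i‖ - ‖y τ i‖)
  simp only [Pi.add_apply]
  nlinarith

/-- A linear map acting in each channel use has bounded energy gain, uniformly in the length. -/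
theorem exists_energy_map_le {a b : ℕ} (T : (Fin a → ℂ) →ₗ[ℂ] Fin b → ℂ) :
    ∃ κ : ℝ, 0 ≤ κ ∧ ∀ (n : ℕ) (x : Fin n → Fin a → ℂ),
      energy (fun τ => T (x τ)) ≤ κ * energy x := by
  let T' : EuclideanSpace ℂ (Fin a) →L[ℂ] EuclideanSpace ℂ (Fin b) := LinearMap.toContinuousLinearMap
    ((WithLp.linearEquiv 2 ℂ (Fin b → ℂ)).symm.toLinearMap ∘ₗ T ∘ₗ
      (WithLp.linearEquiv 2 ℂ (Fin a → ℂ)).toLinearMap)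
  refine ⟨‖T'‖ ^ 2, sq_nonneg _, fun n x => ?_⟩
  simp only [energy, Finset.mul_sum (s := (Finset.univ : Finset (Fin n)))]
  refine Finset.sum_le_sum fun τ _ => ?_
  have h := pow_le_pow_left₀ (norm_nonneg _) (T'.le_opNorm (WithLp.toLp 2 (x τ))) 2
  rw [mul_pow, EuclideanSpace.norm_sq_eq, EuclideanSpace.norm_sq_eq] at h
  exact h

/-- When `A` is onto, finitely many more linear measurements `L`, as many as the dimension of the
kernel of `A`, determine every linear function `B` of the input. -/
theorem exists_complementary_observation {m n₀ k n₁ : ℕ} (A : (Fin m → ℂ) →ₗ[ℂ] Fin n₀ → ℂ)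
    (hA : Function.Surjective A) (h : n₀ + k = m) (B : (Fin m → ℂ) →ₗ[ℂ] Fin n₁ → ℂ) :
    ∃ (L : (Fin m → ℂ) →ₗ[ℂ] Fin k → ℂ) (S : (Fin n₀ → ℂ) →ₗ[ℂ] Fin n₁ → ℂ)
      (S' : (Fin k → ℂ) →ₗ[ℂ] Fin n₁ → ℂ), ∀ x, S (A x) + S' (L x) = B x := by
  obtain ⟨p, hp⟩ := LinearMap.exists_leftInverse_of_injective (LinearMap.ker A).subtype
    (Submodule.ker_subtype _)
  have hk : Module.finrank ℂ (LinearMap.ker A) = Module.finrank ℂ (Fin k → ℂ) := by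
    have h1 := A.finrank_range_add_finrank_ker
    rw [LinearMap.range_eq_top.2 hA, finrank_top] at h1
    simp only [Module.finrank_fin_fun] at h1 ⊢
    omega
  obtain ⟨e⟩ : Nonempty (LinearMap.ker A ≃ₗ[ℂ] (Fin k → ℂ)) :=
    ⟨LinearEquiv.ofFinrankEq _ _ hk⟩
  have hinj : LinearMap.ker (A.prod (e.toLinearMap ∘ₗ p)) = ⊥ := by
    rw [LinearMap.ker_eq_bot']
    intro x hx
    have hx1 : A x = 0 := congrArg Prod.fst hx
    have hx2 : p x = 0 := (LinearEquiv.map_eq_zero_iff e).1 (congrArg Prod.snd hx)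
    have h2 : p x = ⟨x, hx1⟩ := LinearMap.congr_fun hp (⟨x, hx1⟩ : LinearMap.ker A)
    exact (congrArg Subtype.val (h2.symm.trans hx2))
  obtain ⟨g, hg⟩ := LinearMap.exists_leftInverse_of_injective _ hinj
  refine ⟨e.toLinearMap ∘ₗ p, B ∘ₗ g ∘ₗ LinearMap.inl ℂ _ _, B ∘ₗ g ∘ₗ LinearMap.inr ℂ _ _,
    fun x => ?_⟩
  have h3 : g (A x, e (p x)) = x := LinearMap.congr_fun hg x
  change B (g (A x, 0)) + B (g (0, e (p x))) = B x
  rw [← map_add, ← map_add, Prod.mk_add_mk, add_zero, zero_add, h3]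

end LinearGain

section Converse

open scoped ENNReal

variable {M N : Fin 2 → ℕ} {W : Fin 2 → Fin 2 → Type} {n : ℕ}

/-- The noise-free block received by receiver `r` for messages `w`. -/
noncomputable def XCode.signal (c : XCode M N W n) (H : Channel M N) (w : (r t : Fin 2) → W r t)
    (r : Fin 2) : Fin n → Fin (N r) → ℂ :=
  fun τ => ∑ t, Matrix.of (H r t) *ᵥ c.enc t (fun r' => w r' t) τ

/-- The received energy is bounded by the transmit power, uniformly over all codes. -/
theorem exists_energy_signal_le (H : Channel M N) (r : Fin 2) :
    ∃ κ : ℝ, 0 ≤ κ ∧ ∀ (W : Fin 2 → Fin 2 → Type) (n : ℕ) (c : XCode M N W n) (P : ℝ),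
      c.PowerLE P → ∀ w, energy (c.signal H w r) ≤ κ * (n * P) := by
  choose κ hκ0 hκ using fun t => exists_energy_map_le (Matrix.of (H r t)).mulVecLin
  refine ⟨2 * (κ 0 + κ 1), by have := hκ0 0; have := hκ0 1; positivity, fun W n c P hP w => ?_⟩
  have h1 : c.signal H w r =
      (fun τ => (Matrix.of (H r 0)).mulVecLin (c.enc 0 (fun r' => w r' 0) τ)) +
      fun τ => (Matrix.of (H r 1)).mulVecLin (c.enc 1 (fun r' => w r' 1) τ) := by
    funext τ
    simp [XCode.signal]
  rw [h1]
  refine (energy_add_le _ _).trans ?_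
  have h2 : ∀ t, energy (fun τ => (Matrix.of (H r t)).mulVecLin
      (c.enc t (fun r' => w r' t) τ)) ≤ κ t * (n * P) := fun t =>
    (hκ t n _).trans (mul_le_mul_of_nonneg_left (hP t _) (hκ0 t))
  have := h2 0
  have := h2 1
  linarith

theorem XCode.pairwise_disjoint_dec (c : XCode M N W n) (r : Fin 2) :
    Pairwise (Function.onFun Disjoint fun w => c.dec r ⁻¹' {w}) := fun _ _ hww =>
  Disjoint.preimage _ (Set.disjoint_singleton.2 hww)

variable [∀ r t, Fintype (W r t)]

/-- If the average error probability is at most `1/2`, the probabilities of correct decoding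
add up to at least half the number of messages. -/
theorem XCode.card_le_two_mul_sum (c : XCode M N W n) (H : Channel M N)
    (h : c.errorProb H ≤ 1 / 2) :
    (Fintype.card ((r t : Fin 2) → W r t) : ℝ≥0∞) ≤
      2 * ∑ w : (r t : Fin 2) → W r t, ∏ r, blockGaussian n (N r) 1
        {z | c.signal H w r + z ∈ c.dec r ⁻¹' {w r}} := by
  have hm : ∀ w r, MeasurableSet {z | c.signal H w r + z ∈ c.dec r ⁻¹' {w r}} := fun w r =>
    (measurable_const_add (c.signal H w r)) (c.measurable_dec r (w r))
  have h1 : ∀ w : (r t : Fin 2) → W r t, ∏ r, (blockGaussian n (N r) 1).real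
      {z | c.signal H w r + z ∈ c.dec r ⁻¹' {w r}} =
      1 - (noiseLaw N n).real {z | ∃ r, c.dec r (c.output H w z r) ≠ w r} := by
    intro w
    have e1 : {z | ∃ r, c.dec r (c.output H w z r) ≠ w r} =
        (Set.univ.pi fun r => {z | c.signal H w r + z ∈ c.dec r ⁻¹' {w r}})ᶜ := by
      ext z
      simp only [Set.mem_ofPred_eq, Set.mem_compl_iff, Set.mem_univ_pi, not_forall]
      rfl
    rw [e1, measureReal_compl (MeasurableSet.univ_pi (hm w)), probReal_univ, sub_sub_cancel]
    simp only [Measure.real, ← ENNReal.toReal_prod]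
    congr 1
    exact (Measure.pi_pi (fun r => blockGaussian n (N r) 1) _).symm
  rcases Nat.eq_zero_or_pos (Fintype.card ((r t : Fin 2) → W r t)) with h0 | h0
  · simp [h0]
  have h0' : (0 : ℝ) < Fintype.card ((r t : Fin 2) → W r t) := by exact_mod_cast h0
  unfold XCode.errorProb at h
  rw [div_le_iff₀ h0'] at h
  have h2 : (Fintype.card ((r t : Fin 2) → W r t) : ℝ) ≤
      2 * ∑ w : (r t : Fin 2) → W r t, ∏ r, (blockGaussian n (N r) 1).real
        {z | c.signal H w r + z ∈ c.dec r ⁻¹' {w r}} := by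
    simp only [h1, Finset.sum_sub_distrib, Finset.sum_const, Finset.card_univ, nsmul_eq_mul,
      mul_one]
    linarith
  have h3 := ENNReal.ofReal_le_ofReal h2
  rw [ENNReal.ofReal_natCast, ENNReal.ofReal_mul zero_le_two,
    ENNReal.ofReal_sum_of_nonneg fun w _ => Finset.prod_nonneg fun r _ => measureReal_nonneg] at h3
  refine h3.trans (le_of_eq ?_)
  congr 1
  · simp
  · refine Finset.sum_congr rfl fun w _ => ?_
    rw [ENNReal.ofReal_prod_of_nonneg fun r _ => measureReal_nonneg]
    exact Finset.prod_congr rfl fun r _ => ofReal_measureReal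

end Converse

section OuterBound

open scoped ENNReal

variable {M N : Fin 2 → ℕ}

/-- The messages for receiver `1` and one of those for receiver `0`, split off. -/
theorem exists_message_equiv (W : Fin 2 → Fin 2 → Type) (t : Fin 2) :
    ∃ e : (((s : Fin 2) → W 0 s) × W 1 t) × ((j : {j // j ≠ t}) → W 1 j) ≃
        ((r s : Fin 2) → W r s),
      ∀ w, (∀ s, e w 0 s = w.1.1 s) ∧ e w 1 t = w.1.2 ∧ ∀ j : {j // j ≠ t}, e w 1 j = w.2 j := by
  refine ⟨(Equiv.prodAssoc _ _ _).trans (((Equiv.refl _).prodCongr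
    (Equiv.piSplitAt t (W 1)).symm).trans (piFinTwoEquiv fun r => (s : Fin 2) → W r s).symm),
    fun w => ⟨fun s => rfl, ?_, fun j => ?_⟩⟩
  · simp [Equiv.piSplitAt]
  · simp [Equiv.piSplitAt, j.2]

theorem le_of_two_pow_le {n : ℕ} (hn : 0 < n) {R B : ℝ} (hB : 0 < B)
    (h : (2 : ℝ) ^ (n * R) ≤ 2 * B ^ n) : R ≤ 1 + Real.logb 2 B := by
  have hn' : (1 : ℝ) ≤ n := by exact_mod_cast hn
  have h1 := Real.logb_le_logb_of_le one_lt_two (by positivity) h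
  rw [Real.logb_rpow two_pos (by norm_num), Real.logb_mul two_ne_zero (by positivity),
    Real.logb_self_eq_one one_lt_two, Real.logb_pow] at h1
  by_contra hlt
  push Not at hlt
  nlinarith

/-- If `f` has average at least `1 / 2` and sums to at most `C` over each fibre, then fibres have at
most `2 * C` elements. -/
theorem card_le_of_fiberwise_sum_le {α β γ : Type*} [Fintype α] [Fintype β] [Fintype γ]
    [Nonempty β] (e : α × β ≃ γ) (f : γ → ℝ≥0∞) (h : (Fintype.card γ : ℝ≥0∞) ≤ 2 * ∑ w, f w) {C : ℝ}
    (hC : 0 ≤ C) (hf : ∀ b, ∑ a, f (e (a, b)) ≤ ENNReal.ofReal C) :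
    (Fintype.card α : ℝ) ≤ 2 * C := by
  have h1 : ∑ w, f w ≤ Fintype.card β * ENNReal.ofReal C := by
    rw [← e.sum_comp, Fintype.sum_prod_type_right]
    refine (Finset.sum_le_sum fun b _ => hf b).trans (le_of_eq ?_)
    rw [Finset.sum_const, Finset.card_univ, nsmul_eq_mul]
  have h2 := h.trans (mul_le_mul_right h1 2)
  rw [← Fintype.card_congr e, Fintype.card_prod] at h2
  have h3 := ENNReal.toReal_mono (by finiteness) h2
  simp only [ENNReal.toReal_mul, ENNReal.toReal_natCast, ENNReal.toReal_ofNat,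
    ENNReal.toReal_ofReal hC, Nat.cast_mul] at h3
  have h4 : (0 : ℝ) < Fintype.card β := by exact_mod_cast Fintype.card_pos
  refine le_of_mul_le_mul_right ?_ h4
  linarith

/-- The packing bound for inputs of power at most `κ P`, with the noise compared with Gaussian
laws of variance `P`. -/
theorem sum_mul_le_of_power_le {n n₀ k n₁ : ℕ} {W₀ W₁ : Type*} [Fintype W₀]
    [Fintype W₁] {D₀ : W₀ → Set (Fin n → Fin n₀ → ℂ)} {D₁ : W₀ → W₁ → Set (Fin n → Fin n₁ → ℂ)}
    (hD₀ : Pairwise (Function.onFun Disjoint D₀)) (hm₀ : ∀ w, MeasurableSet (D₀ w))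
    (hD₁ : ∀ w, Pairwise (Function.onFun Disjoint (D₁ w))) (hm₁ : ∀ w w', MeasurableSet (D₁ w w'))
    (a₀ : W₀ → Fin n → Fin n₀ → ℂ) (b₀ : W₀ → Fin n → Fin n₁ → ℂ)
    (a : W₀ → W₁ → Fin n → Fin n₀ → ℂ) (l : W₀ → W₁ → Fin n → Fin k → ℂ)
    (S : (Fin n → Fin n₀ → ℂ) → (Fin n → Fin k → ℂ) → Fin n → Fin n₁ → ℂ)
    (hS : ∀ x z y y', S (x + z) (y + y') = S x y + S z y') {s₁ : ℝ≥0}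
    (hs₁ : 2 < s₁) (hSe : ∀ z y, energy (S z y) ≤ (s₁ - 2) / 2 * (energy z + energy y))
    {κ P : ℝ} (hκ : 0 ≤ κ) (hP : 3 ≤ P)
    (hE : ∀ w w', energy (a₀ w + a w w') + energy (l w w') ≤ κ * (n * P)) :
    ∑ w, ∑ w', blockGaussian n n₀ 1 {z | a₀ w + a w w' + z ∈ D₀ w} *
        blockGaussian n n₁ 1 {z | b₀ w + S (a w w') (l w w') + z ∈ D₁ w w'} ≤
      ENNReal.ofReal (((s₁ : ℝ) ^ n₁ * Real.exp (3 * κ) * P ^ (n₀ + k)) ^ n) := by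
  have hs : 2 < P.toNNReal := by
    rw [Real.lt_toNNReal_iff_coe_lt]
    norm_num
    linarith
  refine (sum_mul_le_of_successive_decoding hD₀ hm₀ hD₁ hm₁ a₀ b₀ a l S hS hs hs₁ hSe hE).trans
    (ENNReal.ofReal_le_ofReal ?_)
  rw [Real.coe_toNNReal _ (by linarith), mul_pow, mul_pow, ← pow_mul, ← pow_mul, ← Real.exp_nat_mul,
    mul_comm n n₁, mul_comm n (n₀ + k), mul_assoc, mul_comm (Real.exp (n * (3 * κ)))]
  have h1 : κ * (n * P) / (P - 2) ≤ n * (3 * κ) := by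
    rw [div_le_iff₀ (by linarith)]
    have h2 : 0 ≤ κ * n := by positivity
    nlinarith
  gcongr

/-- Receiver `1` alone decodes its two messages from `N 1` antennas. -/
theorem exists_card_le_of_receiver_one (H : Channel M N) :
    ∃ B : ℝ, 0 < B ∧ ∀ (W : Fin 2 → Fin 2 → Type) [∀ r t, Fintype (W r t)]
      [∀ r t, Nonempty (W r t)] (n : ℕ) (c : XCode M N W n) (P : ℝ), 3 ≤ P → c.PowerLE P →
      c.errorProb H ≤ 1 / 2 →
      (Fintype.card ((t : Fin 2) → W 1 t) : ℝ) ≤ 2 * (B * P ^ N 1) ^ n := by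
  classical
  obtain ⟨κ, hκ0, hκ⟩ := exists_energy_signal_le H 1
  refine ⟨Real.exp (3 * κ), Real.exp_pos _, fun W _ _ n c P hP hc herr => ?_⟩
  refine card_le_of_fiberwise_sum_le
    ((Equiv.prodComm _ _).trans (piFinTwoEquiv fun r => (t : Fin 2) → W r t).symm) _
    (c.card_le_two_mul_sum H herr) (by have : 0 ≤ P := by linarith
                                       positivity) fun u => ?_
  set e := (Equiv.prodComm _ _).trans (piFinTwoEquiv fun r => (t : Fin 2) → W r t).symm
  have h := sum_mul_le_of_power_le (n := n) (n₀ := N 1) (k := 0) (n₁ := 0) (W₁ := Unit)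
    (c.pairwise_disjoint_dec 1) (c.measurable_dec 1) (D₁ := fun _ _ => Set.univ)
    (fun _ x y hxy => (hxy rfl).elim) (fun _ _ => MeasurableSet.univ)
    (fun x => c.signal H (e (x, u)) 1) 0 0 0 0 (by simp) (s₁ := 3) (by norm_num)
    (fun z y => by
      have h0 := energy_nonneg z
      have h1 := energy_nonneg y
      have h2 : energy (0 : Fin n → Fin 0 → ℂ) = 0 := by simp [energy]
      simp only [Pi.zero_apply, h2]
      norm_num
      positivity) hκ0 hP
    (fun x _ => by
      have h2 : energy (0 : Fin n → Fin 0 → ℂ) = 0 := by simp [energy]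
      simpa [h2] using hκ W n c P hc (e (x, u)))
  simp only [Set.mem_univ, Set.ofPred_true, measure_univ, mul_one, pow_zero, one_mul, add_zero,
    Pi.zero_apply, Finset.univ_unique, Finset.sum_const, Finset.card_singleton, one_smul] at h
  refine le_trans (Finset.sum_le_sum fun x _ => ?_) h
  rw [Fin.prod_univ_two]
  calc _ ≤ 1 * _ := mul_le_mul_left prob_le_one _
    _ = _ := one_mul _

/-- Receiver `0` decodes its messages; given these and the message from the other transmitter
to receiver `1`, an observation of `M t` dimensions reveals the message from `t` to `1`. -/
theorem exists_card_le_of_genie (H : Channel M N) {t : Fin 2} {k : ℕ} (hk : N 0 + k = M t)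
    (hsurj : Function.Surjective fun x => Matrix.of (H 0 t) *ᵥ x) :
    ∃ B : ℝ, 0 < B ∧ ∀ (W : Fin 2 → Fin 2 → Type) [∀ r t, Fintype (W r t)]
      [∀ r t, Nonempty (W r t)] (n : ℕ) (c : XCode M N W n) (P : ℝ), 3 ≤ P → c.PowerLE P →
      c.errorProb H ≤ 1 / 2 →
      (Fintype.card (((s : Fin 2) → W 0 s) × W 1 t) : ℝ) ≤ 2 * (B * P ^ M t) ^ n := by
  classical
  obtain ⟨T, S, S', hT⟩ := exists_complementary_observation (Matrix.of (H 0 t)).mulVecLin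
    hsurj hk (Matrix.of (H 1 t)).mulVecLin
  obtain ⟨κ, hκ0, hκ⟩ := exists_energy_signal_le H 0
  obtain ⟨κT, hκT0, hκT⟩ := exists_energy_map_le T
  obtain ⟨κS, hκS0, hκS⟩ := exists_energy_map_le S
  obtain ⟨κS', hκS'0, hκS'⟩ := exists_energy_map_le S'
  -- `energy_add_le` costs a factor `2`, and `sum_mul_le_of_power_le` needs a gain of at most
  -- `(s₁ - 2) / 2`
  let s₁ : ℝ≥0 := ⟨4 * (κS + κS') + 3, by positivity⟩
  have hs₁v : (s₁ : ℝ) = 4 * (κS + κS') + 3 := rfl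
  have hs₁ : 2 < s₁ := by
    rw [← NNReal.coe_lt_coe, hs₁v]
    push_cast
    linarith
  refine ⟨(s₁ : ℝ) ^ N 1 * Real.exp (3 * (κ + κT)), by
    have : (0 : ℝ) < s₁ := by rw [hs₁v]; positivity
    positivity, fun W _ _ n c P hP hc herr => ?_⟩
  have hP0 : 0 ≤ P := by linarith
  obtain ⟨e, he⟩ := exists_message_equiv W t
  refine card_le_of_fiberwise_sum_le e _ (c.card_le_two_mul_sum H herr) (by positivity) fun u => ?_
  -- the messages of the transmitters other than `t` do not involve the message from `t` to `1`
  let m : ((s : Fin 2) → W 0 s) → (j : {j // j ≠ t}) → (r : Fin 2) → W r j := fun w j =>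
    (piFinTwoEquiv fun r => W r j).symm (w j, u j)
  let q : ((s : Fin 2) → W 0 s) → (r : Fin 2) → Fin n → Fin (N r) → ℂ := fun w r τ =>
    ∑ j : {j // j ≠ t}, Matrix.of (H r j) *ᵥ c.enc j (m w j) τ
  let x : ((s : Fin 2) → W 0 s) → W 1 t → Fin n → Fin (M t) → ℂ := fun w w' =>
    c.enc t ((piFinTwoEquiv fun r => W r t).symm (w t, w'))
  have hmsg : ∀ w w', (fun r => e ((w, w'), u) r t) =
      (piFinTwoEquiv fun r => W r t).symm (w t, w') := by
    intro w w'
    obtain ⟨h1, h2, h3⟩ := he ((w, w'), u)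
    funext r
    match r with
    | 0 => exact h1 t
    | 1 => exact h2
  have hmsg' : ∀ w w' (j : {j // j ≠ t}), (fun r => e ((w, w'), u) r j) = m w j := by
    intro w w' j
    obtain ⟨h1, h2, h3⟩ := he ((w, w'), u)
    funext r
    match r with
    | 0 => exact h1 j
    | 1 => exact h3 j
  have hsig : ∀ w w' r, c.signal H (e ((w, w'), u)) r =
      q w r + fun τ => (Matrix.of (H r t)).mulVecLin (x w w' τ) := by
    intro w w' r
    funext τ
    simp only [XCode.signal, Fintype.sum_eq_add_sum_subtype_ne _ t, hmsg, hmsg', Pi.add_apply, q,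
      x, Matrix.mulVecLin_apply]
    exact add_comm _ _
  have h := sum_mul_le_of_power_le (n := n) (n₀ := N 0) (k := k) (n₁ := N 1) (W₁ := W 1 t)
    (c.pairwise_disjoint_dec 0) (c.measurable_dec 0)
    (D₁ := fun w w' => c.dec 1 ⁻¹' {e ((w, w'), u) 1})
    (fun w w₁ w₂ hww => c.pairwise_disjoint_dec 1 fun heq => hww
      ((he ((w, w₁), u)).2.1.symm.trans ((congrFun heq t).trans (he ((w, w₂), u)).2.1)))
    (fun _ _ => c.measurable_dec 1 _)
    (fun w => q w 0) (fun w => q w 1)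
    (fun w w' τ => (Matrix.of (H 0 t)).mulVecLin (x w w' τ)) (fun w w' τ => T (x w w' τ))
    (fun y y' τ => S (y τ) + S' (y' τ))
    (fun y z y' z' => by
      funext τ
      simp only [Pi.add_apply, map_add]
      abel) hs₁
    (fun y y' => by
      refine (energy_add_le (fun τ => S (y τ)) fun τ => S' (y' τ)).trans ?_
      have h1 := hκS n y
      have h2 := hκS' n y'
      have h3 := energy_nonneg y
      have h4 := energy_nonneg y'
      rw [hs₁v]
      nlinarith [mul_nonneg hκS0 h4, mul_nonneg hκS'0 h3])
    (add_nonneg hκ0 hκT0) hP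
    (fun w w' => by
      have h1 := hκ W n c P hc (e ((w, w'), u))
      rw [hsig] at h1
      have h2 := (hκT n (x w w')).trans (mul_le_mul_of_nonneg_left (hc t _) hκT0)
      rw [add_mul]
      exact add_le_add h1 h2)
  rw [hk] at h
  rw [Fintype.sum_prod_type]
  refine le_trans (le_of_eq (Finset.sum_congr rfl fun w _ => Finset.sum_congr rfl fun w' _ => ?_)) h
  rw [Fin.prod_univ_two, hsig, hsig]
  have h0 : e ((w, w'), u) 0 = w := funext (he ((w, w'), u)).1
  simp only [← hT, h0]

/-- A bound on message numbers that holds for all good codes bounds a sum of degrees of freedom. -/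
theorem DoFAchievable.sum_le_of_card_le {H : Channel M N} {d : Fin 2 → Fin 2 → ℝ}
    (h : DoFAchievable H d) (I : Finset (Fin 2 × Fin 2)) {B : ℝ} (hB : 0 < B) (m : ℕ)
    (hcard : ∀ (n : ℕ) (K : Fin 2 → Fin 2 → ℕ) (c : XCode M N (fun r t => Fin (K r t)) n) (P : ℝ),
      (∀ r t, 0 < K r t) → 3 ≤ P → c.PowerLE P → c.errorProb H ≤ 1 / 2 →
      ∏ i ∈ I, (K i.1 i.2 : ℝ) ≤ 2 * (B * P ^ m) ^ n) :
    ∑ i ∈ I, d i.1 i.2 ≤ m := by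
  obtain ⟨R, hR, hd⟩ := h
  have h1 : ∀ᶠ P : ℝ in atTop, ∑ i ∈ I, R P i.1 i.2 ≤
      (1 + Real.logb 2 B) + m * Real.logb 2 P := by
    filter_upwards [hR, eventually_ge_atTop 3] with P hP hP3
    obtain ⟨n, ⟨K, hK, c, hc, he⟩, hn⟩ :=
      ((hP.2 (1 / 2) (by norm_num)).and (eventually_gt_atTop 0)).exists
    have hK0 : ∀ r t, 0 < K r t := fun r t => by
      have : (0 : ℝ) < K r t := lt_of_lt_of_le (by positivity) (hK r t)
      exact_mod_cast this
    have h2 : (2 : ℝ) ^ (n * ∑ i ∈ I, R P i.1 i.2) ≤ 2 * (B * P ^ m) ^ n := by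
      rw [Finset.mul_sum, Real.rpow_sum_of_pos two_pos]
      exact (Finset.prod_le_prod (fun i _ => by positivity) fun i _ => hK i.1 i.2).trans
        (hcard n K c P hK0 hP3 hc he)
    have h3 := le_of_two_pow_le hn (by positivity) h2
    rw [Real.logb_mul hB.ne' (by positivity), Real.logb_pow] at h3
    linarith
  have hlog : Tendsto (fun P => Real.logb 2 P) atTop atTop := Real.tendsto_logb_atTop one_lt_two
  have h4 : Tendsto (fun P => ((1 + Real.logb 2 B) + m * Real.logb 2 P) / Real.logb 2 P) atTop
      (𝓝 (m : ℝ)) := by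
    have h5 : Tendsto (fun P => (1 + Real.logb 2 B) / Real.logb 2 P + m) atTop (𝓝 (0 + (m : ℝ))) :=
      (hlog.const_div_atTop _).add_const _
    rw [zero_add] at h5
    refine h5.congr' ?_
    filter_upwards [hlog.eventually_gt_atTop 0] with P hP
    rw [add_div (1 + Real.logb 2 B), mul_div_cancel_right₀ _ hP.ne']
  have h6 : Tendsto (fun P => (∑ i ∈ I, R P i.1 i.2) / Real.logb 2 P) atTop
      (𝓝 (∑ i ∈ I, d i.1 i.2)) := by
    simp only [Finset.sum_div]
    exact tendsto_finsetSum _ fun i _ => hd i.1 i.2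
  refine le_of_tendsto_of_tendsto h6 h4 ?_
  filter_upwards [h1, hlog.eventually_gt_atTop 0] with P hP hP0
  exact div_le_div_of_nonneg_right hP hP0.le

/-- The three bounds, one for each genie and one for receiver `1`, add up to the outer bound. -/
theorem DoFAchievable.sum_le {H : Channel M N} {d : Fin 2 → Fin 2 → ℝ}
    (hd : DoFAchievable H d) (hMN : ∀ t, N 0 ≤ M t)
    (hsurj : ∀ t, Function.Surjective fun x => Matrix.of (H 0 t) *ᵥ x) :
    ∑ r, ∑ t, d r t ≤ ((M 0 : ℝ) + M 1 + N 1) / 2 := by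
  have h1 : d 1 0 + d 1 1 ≤ N 1 := by
    obtain ⟨B, hB, hcard⟩ := exists_card_le_of_receiver_one H
    have h := hd.sum_le_of_card_le {(1, 0), (1, 1)} hB (N 1) fun n K c P hK hP hc he => by
      have : ∀ r t, Nonempty (Fin (K r t)) := fun r t => Fin.pos_iff_nonempty.1 (hK r t)
      have h := hcard _ n c P hP hc he
      simpa [Fintype.card_pi, Fin.prod_univ_two] using h
    simpa using h
  have h2 : ∀ t, d 0 0 + d 0 1 + d 1 t ≤ M t := by
    intro t
    obtain ⟨k, hk⟩ := Nat.exists_eq_add_of_le (hMN t)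
    obtain ⟨B, hB, hcard⟩ := exists_card_le_of_genie H hk.symm (hsurj t)
    have h := hd.sum_le_of_card_le {(0, 0), (0, 1), (1, t)} hB (M t) fun n K c P hK hP hc he => by
      have : ∀ r t, Nonempty (Fin (K r t)) := fun r t => Fin.pos_iff_nonempty.1 (hK r t)
      have h := hcard _ n c P hP hc he
      simpa [Fintype.card_pi, Fin.prod_univ_two, mul_assoc] using h
    simpa [add_assoc] using h
  have h3 := h2 0
  have h4 := h2 1
  simp only [Fin.sum_univ_two]
  linarith

end OuterBound

/-! ### The optimal scheme -/

/-- In the antenna regime `3 * N 1 < M 0 + M 1 < 2 * N 0 + N 1`, block lengths with the prescribed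
totals exist for which almost every channel admits alignment and cancelation, with `H r t` onto for
all `r` and `t`. -/
theorem exists_blockLengths (M N : Fin 2 → ℕ)
    (hM : M 1 ≤ M 0) (hMN : N 0 ≤ M 1) (hN : N 1 ≤ N 0)
    (hlow : 3 * N 1 < M 0 + M 1) (hupp : M 0 + M 1 < 2 * N 0 + N 1)
    {v : ℝ≥0} (hv : v ≠ 0) :
    ∃ L : BlockLengths, (∀ r t, (L.total r t : ℤ) = messageLength M N r t) ∧
      ∀ᵐ H ∂(channelLaw M N v), (∃ p : Precoders M L, p.IsAlignmentCancelation H) ∧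
        ∀ r t, Function.Surjective fun x => Matrix.of (H r t) *ᵥ x := by
  obtain ⟨k, h0⟩ := Nat.exists_eq_add_of_le (show N 1 ≤ M 0 by omega)
  obtain ⟨k₁, h1⟩ := Nat.exists_eq_add_of_le (show N 1 ≤ M 1 by omega)
  obtain ⟨l₀, h0'⟩ := Nat.exists_eq_add_of_le (show N 0 ≤ M 0 by omega)
  obtain ⟨l₁, h1'⟩ := Nat.exists_eq_add_of_le hMN
  obtain ⟨c, hc⟩ := Nat.exists_eq_add_of_le hupp.le
  -- of the `M 0 + N 1 - M 1` real streams from `0` to `0`, as many as possible share a complex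
  -- direction in pairs; one stream is left over if their number is odd
  set b := (M 0 + N 1 - M 1) / 2 with hb
  set d := (M 0 + N 1 - M 1) % 2 with hd
  refine ⟨alignmentLengths b d c k₁ l₀ l₁, fun r t => ?_, ?_⟩
  · fin_cases r <;> fin_cases t <;>
      simp [BlockLengths.total, alignmentLengths, messageLength] <;> omega
  · have hs : ∀ᵐ H ∂(volume : Measure (Channel M N)), ∀ r t,
        Function.Surjective fun x => Matrix.of (H r t) *ᵥ x :=
      ae_all_iff.2 fun r => ae_all_iff.2 fun t => ae_mulVec_surjective r t (by
        fin_cases r <;> fin_cases t <;> simp <;> omega)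
    have hg := ae_exists_isGeneric (M := M) (N := N) (b := b) (d := d) (c := c) h0.symm h1.symm
      (by omega) (by omega) h0'.symm h1'.symm (by omega) (by omega)
    refine (channelLaw_absolutelyContinuous M N hv).ae_le ?_
    filter_upwards [hs, hg] with H hsH hgH
    obtain ⟨f, g, Th, hH⟩ := hgH
    exact ⟨exists_isAlignmentCancelation hH h0.symm h1.symm h0'.symm h1'.symm hsH, hsH⟩

theorem sum_messageLength (M N : Fin 2 → ℕ) :
    ∑ r, ∑ t, (messageLength M N r t : ℝ) / 2 = ((M 0 : ℝ) + M 1 + N 1) / 2 := by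
  simp only [Fin.sum_univ_two, messageLength, Matrix.of_apply, Matrix.cons_val', Matrix.cons_val_zero,
    Matrix.cons_val_one, Matrix.cons_val_fin_one]
  push_cast
  ring

end MIMOX

theorem theorem1 (M N : Fin 2 → ℕ)
    (hM : M 1 ≤ M 0) (hMN : N 0 ≤ M 1) (hN : N 1 ≤ N 0)
    (hlow : 3 * N 1 < M 0 + M 1) (hupp : M 0 + M 1 < 2 * N 0 + N 1)
    (v : ℝ≥0) (hv : v ≠ 0) :
    (∃ L : MIMOX.BlockLengths,
      (∀ r t, (L.total r t : ℤ) = MIMOX.messageLength M N r t) ∧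
      ∀ᵐ H ∂(MIMOX.channelLaw M N v), ∃ p : MIMOX.Precoders M L,
        p.IsAlignmentCancelation H ∧ p.DoFAchievable H (fun _ _ _ => 1 / 2)) ∧
    ∀ᵐ H ∂(MIMOX.channelLaw M N v),
      MIMOX.DoFAchievable H (fun r t => (MIMOX.messageLength M N r t : ℝ) / 2) ∧
      ∑ r, ∑ t, (MIMOX.messageLength M N r t : ℝ) / 2 = ((M 0 : ℝ) + M 1 + N 1) / 2 ∧
      IsGreatest {D : ℝ | ∃ d : Fin 2 → Fin 2 → ℝ,
          MIMOX.DoFAchievable H d ∧ D = ∑ r, ∑ t, d r t}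
        (((M 0 : ℝ) + M 1 + N 1) / 2) := by
  obtain ⟨L, hL, hae⟩ := MIMOX.exists_blockLengths M N hM hMN hN hlow hupp hv
  refine ⟨⟨L, hL, ?_⟩, ?_⟩
  · filter_upwards [hae] with H hH
    obtain ⟨⟨p, hp⟩, -⟩ := hH
    exact ⟨p, hp, hp.doFAchievable⟩
  · filter_upwards [hae] with H hH
    obtain ⟨⟨p, hp⟩, hs⟩ := hH
    have hd : MIMOX.DoFAchievable H fun r t => (MIMOX.messageLength M N r t : ℝ) / 2 := by
      have h := hp.doFAchievable.sum
      have hcard : ∀ r t, ∑ _s : L.Stream r t, (1 / 2 : ℝ) =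
          (MIMOX.messageLength M N r t : ℝ) / 2 := by
        intro r t
        rw [← hL r t, Finset.sum_const, Finset.card_univ, Fintype.card_sum, Fintype.card_sum,
          Fintype.card_fin, Fintype.card_fin, Fintype.card_fin, nsmul_eq_mul]
        simp only [MIMOX.BlockLengths.total]
        push_cast
        ring
      simpa only [hcard] using h
    refine ⟨hd, MIMOX.sum_messageLength M N, ⟨_, hd, (MIMOX.sum_messageLength M N).symm⟩, ?_⟩
    rintro D ⟨d, hd', rfl⟩
    exact hd'.sum_le (fun t => by fin_cases t <;> simp <;> omega) fun t => hs 0 t
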